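/- Let $m\ge 1$, $p\ge 0$ and $$\Delta_m=\Big\{y\in[0,1]^m:\sum_{i}y_i\le 1\Big\},\qquad \Delta_m^0=\{y\in\Delta_m: y_i>0\ \text{for all } i\}.$$ Let $\mathscr X\subset\mathbb R^p$ be compact. For each $x\in\mathscr X$ let $v_x:\mathbb R\to(0,1)$ and $h_x:\mathbb R^m\to\operatorname{int}\Delta_m$ be continuous bijections such that, for all $a\in\mathbb R$, $b\in\mathbb R^m$, the maps $x\mapsto v_x(a)$ and $x\mapsto h_x(b)$ are continuous on $\mathscr X$. Let $k$ be a random variable with values in $\{1,2,\dots\}$. Consider one of the following three models, in each of which the family determining the weights, the family determining the atoms, and $k$ are mutually independent; all processes are assumed measurable jointly in $x$ and the chance variable. * **DMBPP**: $(\eta_j)_{j\ge1}$ are i.i.d. real-valued processes on $\mathscr X$, $(z_j)_{j\ge1}$ are i.i.d. $\mathbb R^m$-valued processes on $\mathscr X$; $V_j(x)=v_x(\eta_j(x))$ and $\theta_j(x)=h_x(z_j(x))$. * **$\theta$DMBPP**: $(\eta_j)$ and $V_j(x)$ as above; $\theta_j(x)=\theta_j$, where $(\theta_j)_{j\ge1}$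 are i.i.d. $\Delta_m^0$-valued random vectors. * **$w$DMBPP**: $(z_j)$ and $\theta_j(x)$ as above; $V_j(x)=V_j$, where $(V_j)_{j\ge1}$ are i.i.d. $[0,1]$-valued random variables. The model defines the random conditional densities on $\Delta_m$ (with respect to Lebesgue measure) $$f_x(y)=\sum_{j\ge1}w_j(x)\,\mathrm{dir}\big(y\mid\alpha(k,\lceil k\theta_j(x)\rceil)\big),\qquad w_j(x)=V_j(x)\prod_{l<j}(1-V_l(x)),$$ where $\lceil\cdot\rceil$ acts coordinatewise, $\alpha(k,\mathbf j)=(\mathbf j,\,k+m-\|\mathbf j\|_1)$, and $\mathrm{dir}(\cdot\mid\alpha_1,\dots,\alpha_{m+1})$ is the Dirichlet density. Assume that $\Pr\{k=n\}>0$ for every $n\ge1$ and that those of the following conditions that concern ingredients of the chosen model hold: 1. (DMBPP, $w$DMBPP) for every continuous $f:\mathscr X\to\Delta_m^0$, every $j$ and every $\epsilon>0$, $\Pr\{\sup_{x\in\mathscr X}\|h_x(z_j(x))-f(x)\|<\epsilon\}>0$; 2. (DMBPP, $\theta$DMBPP) for every continuous $f:\mathscr X\to[0,1]$, every $j$ and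 every $\epsilon>0$, $\Pr\{\sup_{x\in\mathscr X}|v_x(\eta_j(x))-f(x)|<\epsilon\}>0$; 3. ($w$DMBPP) each $V_j$ has full support on $[0,1]$; 4. ($\theta$DMBPP) each $\theta_j$ has full support on $\Delta_m^0$. Let $\nu$ be a $\sigma$-finite measure on $\mathscr X$, $q$ a probability density with respect to $\nu$ (the density generating the predictors), and $\{q_0(\cdot\mid x):x\in\mathscr X\}$ a family of probability densities on $\Delta_m$ with respect to Lebesgue measure such that $(y,x)\mapsto q_0(y\mid x)$ is continuous on $\Delta_m\times\mathscr X$. Let $P_0$ be the law on $\Delta_m\times\mathscr X$ with density $h_0(y,x)=q(x)q_0(y\mid x)$ with respect to the product of Lebesgue measure and $\nu$. Then the posterior distribution of the random joint density $h(y,x)=q(x)f_x(y)$ is weakly consistent at $P_0$: if $(y_1,x_1),(y_2,x_2),\dots$ are i.i.d. with law $P_0$, then, almost surely, for every neighborhood $U$ of $P_0$ in the topology of weak convergence of probability measures on $\Delta_m\times\mathscr X$, $$\Pr\big\{h\in U\mid (y_1,x_1),\dots,(y_n,x_n)\big\}=\frac{\mathrm E\big[\mathbf 1\{h\in U\}\prod_{i=1}^n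 h(y_i,x_i)\big]}{\mathrm E\big[\prod_{i=1}^n h(y_i,x_i)\big]}\longrightarrow 1\qquad(n\to\infty),$$ where $\mathrm E$ is the expectation under the prior (the data being fixed) and $h\in U$ means that the law with density $h$ belongs to $U$. -/

import Mathlib

open MeasureTheory ProbabilityTheory Filter Topology
open scoped ENNReal

noncomputable section

namespace DMBPP

/-! ### The simplex -/

/-- The simplex `Δ_m = {y ∈ [0,1]^m : ∑ y_i ≤ 1}`. -/
def simplex (m : ℕ) : Set (Fin m → ℝ) :=
  {y | (∀ i, y i ∈ Set.Icc (0 : ℝ) 1) ∧ ∑ i, y i ≤ 1}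

/-- Lebesgue measure of `ℝ^m`, restricted to the simplex `Δ_m`. -/
def lebesgue (m : ℕ) : Measure (simplex m) :=
  (volume : Measure (Fin m → ℝ)).comap Subtype.val

/-- `Δ_m^0 = {y ∈ Δ_m : y_i > 0 for all i}`. -/
def simplexPos (m : ℕ) : Set (Fin m → ℝ) :=
  {y | y ∈ simplex m ∧ ∀ i, 0 < y i}

/-- The topological interior of `Δ_m`: all `y_i > 0` and `∑ y_i < 1`. -/
def simplexInterior (m : ℕ) : Set (Fin m → ℝ) :=
  {y | (∀ i, 0 < y i) ∧ ∑ i, y i < 1}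

/-! ### Dirichlet densities and the dependent mixtures -/

/-- Density at `y ∈ Δ_m`, with respect to Lebesgue measure, of the `m`-dimensional Dirichlet
distribution with parameters `(α_1, …, α_{m+1})`. -/
def dirichletDensity {m : ℕ} (α : Fin (m + 1) → ℝ) (y : Fin m → ℝ) : ℝ :=
  Real.Gamma (∑ i, α i) / (∏ i, Real.Gamma (α i)) *
    ((∏ i : Fin m, y i ^ (α i.castSucc - 1)) * (1 - ∑ i, y i) ^ (α (Fin.last m) - 1))

/-- The parameter vector `α(k, ⌈kθ⌉) = (⌈kθ⌉, k + m - ‖⌈kθ⌉‖₁)`. -/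
def dirichletParam {m : ℕ} (k : ℕ) (θ : Fin m → ℝ) : Fin (m + 1) → ℝ :=
  Fin.snoc (α := fun _ => ℝ) (fun i => (⌈(k : ℝ) * θ i⌉ : ℝ))
    ((k : ℝ) + m - ∑ i, (⌈(k : ℝ) * θ i⌉ : ℝ))

/-- Stick-breaking weights `w_j = V_j ∏_{l < j} (1 - V_l)`. -/
def stickWeight (V : ℕ → ℝ) (j : ℕ) : ℝ :=
  V j * ∏ l ∈ Finset.range j, (1 - V l)

/-- The mixture `∑_j w_j dir(y ∣ α(k, ⌈kθ_j⌉))` with stick-breaking weights. -/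
def mixtureDensity {m : ℕ} (k : ℕ) (V : ℕ → ℝ) (θ : ℕ → Fin m → ℝ) (y : simplex m) : ℝ :=
  ∑' j, stickWeight V j * dirichletDensity (dirichletParam k (θ j)) (y : Fin m → ℝ)

section Models

variable {Ω : Type*} [MeasurableSpace Ω] {m p : ℕ} {X : Set (Fin p → ℝ)}

/-! ### The three classes of processes -/

/-- The set `𝒱 = {v_x}` of link functions for the weights: each `v_x` is a continuous bijection
of `ℝ` onto `(0,1)`, and `v_x(a)` is continuous in `x` for every `a`. -/
structure IsWeightLink (v : X → ℝ → ℝ) : Prop where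
  continuous : ∀ x, Continuous (v x)
  bijOn : ∀ x, Set.BijOn (v x) Set.univ (Set.Ioo 0 1)
  continuous_left : ∀ a, Continuous fun x => v x a

/-- The set `ℋ = {h_x}` of link functions for the atoms: each `h_x` is a continuous bijection
of `ℝ^m` onto the interior of `Δ_m`, and `h_x(b)` is continuous in `x` for every `b`. -/
structure IsAtomLink (h : X → (Fin m → ℝ) → (Fin m → ℝ)) : Prop where
  continuous : ∀ x, Continuous (h x)
  bijOn : ∀ x, Set.BijOn (h x) Set.univ (simplexInterior m)
  continuous_left : ∀ b, Continuous fun x => h x b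

/-- `ξ_0, ξ_1, …` are independent and identically distributed `E`-valued stochastic processes
indexed by `X`, measurable in `(x, ω)`.  Their laws are laws on `X → E` with the product
`σ`-algebra. -/
structure IsIIDProcesses {E : Type*} [MeasurableSpace E] (P : Measure Ω)
    (ξ : ℕ → X → Ω → E) : Prop where
  measurable : ∀ j, Measurable fun a : X × Ω => ξ j a.1 a.2
  indep : iIndepFun (fun j (ω : Ω) (x : X) => ξ j x ω) P
  identDistrib : ∀ i j,
    IdentDistrib (fun (ω : Ω) (x : X) => ξ i x ω) (fun (ω : Ω) (x : X) => ξ j x ω) P P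

/-- `ξ_0, ξ_1, …` are independent and identically distributed random elements of `E`. -/
structure IsIIDVariables {E : Type*} [MeasurableSpace E] (P : Measure Ω)
    (ξ : ℕ → Ω → E) : Prop where
  measurable : ∀ j, Measurable (ξ j)
  indep : iIndepFun ξ P
  identDistrib : ∀ i j, IdentDistrib (ξ i) (ξ j) P P

/-- The degree `k` is a random variable with values in `{1, 2, …}`. -/
structure IsDegree (k : Ω → ℕ) : Prop where
  measurable : Measurable k
  one_le : ∀ ω, 1 ≤ k ω

/-- The ingredients of a DMBPP: i.i.d. real processes `η_j`, i.i.d. `ℝ^m`-valued processes `z_j`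
and a random degree `k`; the three ingredients are mutually independent. -/
structure IsDMBPP (P : Measure Ω) (k : Ω → ℕ) (v : X → ℝ → ℝ)
    (h : X → (Fin m → ℝ) → (Fin m → ℝ)) (η : ℕ → X → Ω → ℝ)
    (z : ℕ → X → Ω → (Fin m → ℝ)) : Prop where
  weightLink : IsWeightLink v
  atomLink : IsAtomLink h
  degree : IsDegree k
  iid_weight : IsIIDProcesses P η
  iid_atom : IsIIDProcesses P z
  indep_weight : IndepFun (fun ω j x => η j x ω) (fun ω => (fun j x => z j x ω, k ω)) P
  indep_atom : IndepFun (fun ω j x => z j x ω) k P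

/-- The ingredients of a single-atoms process `θDMBPP`: i.i.d. real processes `η_j`, i.i.d.
`Δ_m^0`-valued random vectors `θ_j` and a random degree `k`, mutually independent. -/
structure IsThetaDMBPP (P : Measure Ω) (k : Ω → ℕ) (v : X → ℝ → ℝ) (η : ℕ → X → Ω → ℝ)
    (θ : ℕ → Ω → (Fin m → ℝ)) : Prop where
  weightLink : IsWeightLink v
  degree : IsDegree k
  iid_weight : IsIIDProcesses P η
  iid_atom : IsIIDVariables P θ
  atom_mem : ∀ j ω, θ j ω ∈ simplexPos m
  indep_weight : IndepFun (fun ω j x => η j x ω) (fun ω => (fun j => θ j ω, k ω)) P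
  indep_atom : IndepFun (fun ω j => θ j ω) k P

/-- The ingredients of a single-weights process `wDMBPP`: i.i.d. `[0,1]`-valued variables `V_j`,
i.i.d. `ℝ^m`-valued processes `z_j` and a random degree `k`, mutually independent. -/
structure IsWDMBPP (P : Measure Ω) (k : Ω → ℕ) (h : X → (Fin m → ℝ) → (Fin m → ℝ))
    (V : ℕ → Ω → ℝ) (z : ℕ → X → Ω → (Fin m → ℝ)) : Prop where
  atomLink : IsAtomLink h
  degree : IsDegree k
  iid_weight : IsIIDVariables P V
  weight_mem : ∀ j ω, V j ω ∈ Set.Icc (0 : ℝ) 1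
  iid_atom : IsIIDProcesses P z
  indep_weight : IndepFun (fun ω j => V j ω) (fun ω => (fun j x => z j x ω, k ω)) P
  indep_atom : IndepFun (fun ω j x => z j x ω) k P

/-- The random conditional densities `f_x(y)` of a DMBPP. -/
def densityDMBPP (k : Ω → ℕ) (v : X → ℝ → ℝ) (h : X → (Fin m → ℝ) → (Fin m → ℝ))
    (η : ℕ → X → Ω → ℝ) (z : ℕ → X → Ω → (Fin m → ℝ)) (ω : Ω) (x : X) (y : simplex m) : ℝ :=
  mixtureDensity (k ω) (fun j => v x (η j x ω)) (fun j => h x (z j x ω)) y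

/-- The random conditional densities `f_x(y)` of a `θDMBPP`. -/
def densityThetaDMBPP (k : Ω → ℕ) (v : X → ℝ → ℝ) (η : ℕ → X → Ω → ℝ)
    (θ : ℕ → Ω → (Fin m → ℝ)) (ω : Ω) (x : X) (y : simplex m) : ℝ :=
  mixtureDensity (k ω) (fun j => v x (η j x ω)) (fun j => θ j ω) y

/-- The random conditional densities `f_x(y)` of a `wDMBPP`. -/
def densityWDMBPP (k : Ω → ℕ) (h : X → (Fin m → ℝ) → (Fin m → ℝ)) (V : ℕ → Ω → ℝ)
    (z : ℕ → X → Ω → (Fin m → ℝ)) (ω : Ω) (x : X) (y : simplex m) : ℝ :=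
  mixtureDensity (k ω) (fun j => V j ω) (fun j => h x (z j x ω)) y

/-! ### Support conditions on the ingredients -/

/-- Every `Δ_m^0`-valued continuous function on `X` is uniformly approximated by every atom
process `x ↦ h_x(z_j(x))` with positive probability. -/
def AtomProcessFullSupport (P : Measure Ω) (h : X → (Fin m → ℝ) → (Fin m → ℝ))
    (z : ℕ → X → Ω → (Fin m → ℝ)) : Prop :=
  ∀ f : X → (Fin m → ℝ), Continuous f → (∀ x, f x ∈ simplexPos m) → ∀ j, ∀ ε > (0 : ℝ),
    0 < P {ω | ⨆ x : X, ‖h x (z j x ω) - f x‖ < ε}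

/-- Every `[0,1]`-valued continuous function on `X` is uniformly approximated by every weight
process `x ↦ v_x(η_j(x))` with positive probability. -/
def WeightProcessFullSupport (P : Measure Ω) (v : X → ℝ → ℝ) (η : ℕ → X → Ω → ℝ) : Prop :=
  ∀ f : X → ℝ, Continuous f → (∀ x, f x ∈ Set.Icc (0 : ℝ) 1) → ∀ j, ∀ ε > (0 : ℝ),
    0 < P {ω | ⨆ x : X, |v x (η j x ω) - f x| < ε}

/-- The random element `ξ` has full support on the set `S`. -/
def HasFullSupportOn {E : Type*} [TopologicalSpace E] [MeasurableSpace E] (P : Measure Ω)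
    (ξ : Ω → E) (S : Set E) : Prop :=
  S ⊆ (P.map ξ).support

end Models

/-! ### Joint laws of responses and predictors -/

section JointLaw

variable {m p : ℕ} {X : Set (Fin p → ℝ)}

/-- `q` is a probability density on the predictor space with respect to `ν`. -/
structure IsPredictorDensity (ν : Measure X) (q : X → ℝ) : Prop where
  measurable : Measurable q
  nonneg : ∀ x, 0 ≤ q x
  lintegral_eq_one : ∫⁻ x, ENNReal.ofReal (q x) ∂ν = 1

/-- `q₀` is a family of conditional probability densities on `Δ_m` (with respect to Lebesgue
measure) indexed by `X` such that `(y, x) ↦ q₀(y ∣ x)` is continuous. -/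
structure IsContinuousDensityFamily (q₀ : X → simplex m → ℝ) : Prop where
  nonneg : ∀ x y, 0 ≤ q₀ x y
  lintegral_eq_one : ∀ x, ∫⁻ y, ENNReal.ofReal (q₀ x y) ∂(lebesgue m) = 1
  continuous : Continuous fun a : simplex m × X => q₀ a.2 a.1

/-- The joint density `q(x) f_x(y)` at `(y, x)`. -/
def jointDensity (q : X → ℝ) (f : X → simplex m → ℝ) (a : simplex m × X) : ℝ :=
  q a.2 * f a.2 a.1

/-- The measure with (nonnegative) density `g` with respect to `μ`. -/
def densityMeasure {E : Type*} [MeasurableSpace E] (μ : Measure E) (g : E → ℝ) : Measure E :=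
  μ.withDensity fun a => ENNReal.ofReal (g a)

theorem measurableSet_simplex (m : ℕ) : MeasurableSet (simplex m) := by
  have h1 : IsClosed {y : Fin m → ℝ | ∀ i, y i ∈ Set.Icc (0 : ℝ) 1} := by
    simp only [Set.ofPred_forall]
    exact isClosed_iInter fun i => isClosed_Icc.preimage (continuous_apply i)
  have h2 : IsClosed {y : Fin m → ℝ | ∑ i, y i ≤ 1} :=
    isClosed_le (by fun_prop) continuous_const
  exact (h1.inter h2).measurableSet

instance isFiniteMeasure_lebesgue (m : ℕ) : IsFiniteMeasure (lebesgue m) := by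
  constructor
  rw [lebesgue, (MeasurableEmbedding.subtype_coe (measurableSet_simplex m)).comap_apply,
    Set.image_univ, Subtype.range_coe]
  refine lt_of_le_of_lt (measure_mono (t := Set.Icc (0 : Fin m → ℝ) 1) ?_)
    measure_Icc_lt_top
  intro y hy
  exact ⟨fun i => (hy.1 i).1, fun i => (hy.1 i).2⟩

theorem isProbabilityMeasure_joint {ν : Measure X} [SigmaFinite ν] {q : X → ℝ}
    {q₀ : X → simplex m → ℝ} (hq : IsPredictorDensity ν q)
    (hq₀ : IsContinuousDensityFamily q₀) :
    IsProbabilityMeasure (densityMeasure ((lebesgue m).prod ν) (jointDensity q q₀)) := by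
  constructor
  have hc : Measurable fun a : simplex m × X => q₀ a.2 a.1 := hq₀.continuous.measurable
  have hm : Measurable fun a : simplex m × X => ENNReal.ofReal (jointDensity q q₀ a) :=
    ((hq.measurable.comp measurable_snd).mul hc).ennreal_ofReal
  rw [densityMeasure, withDensity_apply _ MeasurableSet.univ, Measure.restrict_univ,
    lintegral_prod_symm _ hm.aemeasurable, ← hq.lintegral_eq_one]
  refine lintegral_congr fun x => ?_
  simp only [jointDensity, ENNReal.ofReal_mul (hq.nonneg x)]
  rw [lintegral_const_mul', hq₀.lintegral_eq_one, mul_one]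
  exact ENNReal.ofReal_ne_top

/-- The true law of `(y, x)`, with density `q(x) q₀(y ∣ x)` with respect to the product of
Lebesgue measure on `Δ_m` and `ν`. -/
def trueLaw {ν : Measure X} [SigmaFinite ν] {q : X → ℝ} {q₀ : X → simplex m → ℝ}
    (hq : IsPredictorDensity ν q) (hq₀ : IsContinuousDensityFamily q₀) :
    ProbabilityMeasure (simplex m × X) :=
  ⟨densityMeasure ((lebesgue m).prod ν) (jointDensity q q₀), isProbabilityMeasure_joint hq hq₀⟩

end JointLaw

/-! ### Posterior and weak consistency -/

/-- Bayes' formula: the posterior mass of the event `A` under the prior `P` when the likelihood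
of the parameter `ω` is `L ω`. -/
def posterior {Ω : Type*} [MeasurableSpace Ω] (P : Measure Ω) (L : Ω → ℝ≥0∞) (A : Set Ω) :
    ℝ≥0∞ :=
  (∫⁻ ω in A, L ω ∂P) / ∫⁻ ω, L ω ∂P

/-- Let `h ω` be a random density on `E` with respect to `μ`, `ω` having the prior law `P`.  Its
posterior, given an i.i.d. sample `d 0, …, d (n - 1)`, is weakly consistent at `P₀` if, for
almost every sample sequence drawn from `P₀`, the posterior mass of every neighborhood of `P₀` in
the topology of weak convergence tends to `1`. -/
def PosteriorWeaklyConsistentAt {Ω E : Type*} [MeasurableSpace Ω] [MeasurableSpace E]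
    [TopologicalSpace E] [OpensMeasurableSpace E] (P : Measure Ω) (μ : Measure E)
    (h : Ω → E → ℝ) (P₀ : ProbabilityMeasure E) : Prop :=
  ∀ᵐ d ∂(Measure.infinitePi fun _ : ℕ => (P₀ : Measure E)),
    ∀ U ∈ 𝓝 P₀,
      Tendsto
        (fun n : ℕ => posterior P (fun ω => ∏ i ∈ Finset.range n, ENNReal.ofReal (h ω (d i)))
          {ω | ∃ R ∈ U, (R : Measure E) = densityMeasure μ (h ω)})
        atTop (𝓝 1)

end DMBPP

end

/-!
Weak consistency is deduced from Schwartz's theorem, in which the Kullback–Leibler condition is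
replaced by a pointwise one: for every `t < 1` the prior gives probability at least some `c > 0`,
the same for all finite sets `D` of predictors, to the event that `f_x(y) ≥ t q₀(y ∣ x)` for all
`x ∈ D` and all `y`.  With `D` the observed predictors, this bounds the evidence
`E ∏ h(y_i, x_i)` below by `c tⁿ ∏ h₀(y_i, x_i)` (`DominatesTruth`).  A basic weak neighborhood of
the true law is cut out by finitely many integrals of bounded continuous functions `u`.  For the
laws whose integral of `u` exceeds the true one by `ε` or more, let `a` be the true value plus
`ε / 2`; for small `l` the function `exp(l (u - a))` has mean less than one under the truth, and its
inverse has mean less than one under each of these laws.  By Borel–Cantelli the numerator of their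
posterior mass is then geometrically smaller than `∏ h₀(y_i, x_i)` (`ae_tendsto_posterior_zero`,
`posteriorWeaklyConsistentAt_of_dominatesTruth`).  That the random `h` is almost surely a
probability density rests on the Dirichlet integral (`lintegral_dirichletDensity`) and on the almost
sure exhaustion of the stick at almost every predictor.

For the pointwise bound, the Dirichlet densities `dir(· ∣ α(k, j))` are multiples of the Bernstein
polynomials of degree `k - 1` on the simplex, so a rescaled Bernstein polynomial of `q₀ + δ` is a
finite mixture with continuous weights `W_i(x)`, of total mass less than one, which exceeds `t q₀`
and still does so after a small perturbation (`nonempty_finiteMixtureBelow`).  Bernstein polynomials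
are written as sums over words, that is, as expectations over `n` independent letters.  The mixture
is imitated in two ways:

* with constant atoms and weights depending on the predictor, the target for `V_j(x)` being the
  stick-breaking fraction that produces `W_j(x)`;
* with constant weights and moving atoms: many atoms of equal weight travel, as `x` varies, along a
  path that rests at the finitely many prescribed atoms, so that about a fraction `W_i(x)` of them
  is at rest at the `i`-th one; the others only increase the mixture.

The first way serves the DMBPP and the `θDMBPP`, the second one the `wDMBPP`.  The support
conditions and independence give such targets positive prior probability.  Suprema over all
predictors need not be measurable; hence the restriction to finite sets of predictors (`ChargesTubes`).
-/

noncomputable section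

namespace DMBPP

/-! ### Schwartz's theorem -/

/-- A neighborhood of `P₀` for weak convergence is controlled by finitely many integrals of bounded
continuous functions. -/
theorem nhds_probabilityMeasure_eq_iInf {E : Type*} [MeasurableSpace E] [TopologicalSpace E]
    [OpensMeasurableSpace E] (P₀ : ProbabilityMeasure E) :
    𝓝 P₀ = ⨅ f : BoundedContinuousFunction E ℝ,
      comap (fun R : ProbabilityMeasure E => ∫ e, f e ∂(R : Measure E))
        (𝓝 (∫ e, f e ∂(P₀ : Measure E))) := by
  refine le_antisymm (le_iInf fun f => ?_) ?_
  · exact tendsto_iff_comap.1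
      (ProbabilityMeasure.tendsto_iff_forall_integral_tendsto.1 (tendsto_id (α := _)) f)
  · have : Tendsto id (⨅ f : BoundedContinuousFunction E ℝ,
        comap (fun R : ProbabilityMeasure E => ∫ e, f e ∂(R : Measure E))
          (𝓝 (∫ e, f e ∂(P₀ : Measure E)))) (𝓝 P₀) :=
      ProbabilityMeasure.tendsto_iff_forall_integral_tendsto.2 fun f =>
        tendsto_comap.mono_left (iInf_le _ f)
    exact this

/-- A second-order bound on the exponential moment of a bounded function with negative mean,
uniform over all probability measures. -/
theorem lintegral_exp_le {E : Type*} [MeasurableSpace E] {C η l : ℝ}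
    (hl : 0 < l) (hlC : l * C ≤ 1) (hlη : l * C ^ 2 ≤ η / 2) (Q : Measure E)
    [IsProbabilityMeasure Q] {f : E → ℝ} (hf : Measurable f) (hfC : ∀ e, |f e| ≤ C)
    (hmean : ∫ e, f e ∂Q ≤ -η) :
    ∫⁻ e, ENNReal.ofReal (Real.exp (l * f e)) ∂Q ≤ ENNReal.ofReal (Real.exp (-(l * η / 2))) := by
  have hint : Integrable f Q := Integrable.of_bound hf.aestronglyMeasurable C (ae_of_all _ hfC)
  have hpt : ∀ e, Real.exp (l * f e) ≤ 1 + l * f e + l ^ 2 * C ^ 2 := by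
    intro e
    have h1 : |l * f e| ≤ 1 := by
      rw [abs_mul, abs_of_pos hl]
      exact (mul_le_mul_of_nonneg_left (hfC e) hl.le).trans hlC
    have h2 := (abs_le.1 (Real.abs_exp_sub_one_sub_id_le h1)).2
    have h3 : f e ^ 2 ≤ C ^ 2 := sq_le_sq' (abs_le.1 (hfC e)).1 (abs_le.1 (hfC e)).2
    nlinarith [mul_le_mul_of_nonneg_left h3 (sq_nonneg l)]
  have hint2 : Integrable (fun e => 1 + l * f e + l ^ 2 * C ^ 2) Q :=
    ((integrable_const _).add (hint.const_mul l)).add (integrable_const _)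
  have hval : ∫ e, (1 + l * f e + l ^ 2 * C ^ 2) ∂Q = 1 + l * ∫ e, f e ∂Q + l ^ 2 * C ^ 2 := by
    have h1 : Integrable (fun e => l * f e) Q := hint.const_mul l
    have h2 : Integrable (fun e => 1 + l * f e) Q := (integrable_const _).add h1
    rw [integral_add h2 (integrable_const _), integral_add (integrable_const _) h1,
      integral_const_mul]
    simp
  calc ∫⁻ e, ENNReal.ofReal (Real.exp (l * f e)) ∂Q
      ≤ ∫⁻ e, ENNReal.ofReal (1 + l * f e + l ^ 2 * C ^ 2) ∂Q :=
        lintegral_mono fun e => ENNReal.ofReal_le_ofReal (hpt e)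
    _ = ENNReal.ofReal (1 + l * ∫ e, f e ∂Q + l ^ 2 * C ^ 2) := by
        rw [← hval, ofReal_integral_eq_lintegral_ofReal hint2]
        exact ae_of_all _ fun e => (Real.exp_pos _).le.trans (hpt e)
    _ ≤ _ := by
        apply ENNReal.ofReal_le_ofReal
        have := Real.add_one_le_exp (-(l * η / 2))
        nlinarith [mul_le_mul_of_nonneg_left hmean hl.le, mul_le_mul_of_nonneg_left hlη hl.le]

/-- Borel–Cantelli for random variables whose expectations decay geometrically. -/
theorem ae_eventually_le_pow {D : Type*} [MeasurableSpace D] {Q : Measure D} {Y : ℕ → D → ℝ≥0∞}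
    (hY : ∀ n, AEMeasurable (Y n) Q) {t : ℝ≥0∞} (ht0 : t ≠ 0) (ht1 : t < 1)
    (hE : ∀ n, ∫⁻ d, Y n d ∂Q ≤ (t * t) ^ n) :
    ∀ᵐ d ∂Q, ∀ᶠ n in atTop, Y n d ≤ t ^ n := by
  have hlt : ∀ n, Q {d | t ^ n ≤ Y n d} ≤ t ^ n := by
    intro n
    have h0 : t ^ n ≠ 0 := pow_ne_zero _ ht0
    have hT : t ^ n ≠ ∞ := ENNReal.pow_ne_top ht1.ne_top
    refine (meas_ge_le_lintegral_div (hY n) h0 hT).trans ?_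
    rw [ENNReal.div_le_iff h0 hT]
    simpa [mul_pow] using hE n
  have hsum : ∑' n, Q {d | t ^ n ≤ Y n d} ≠ ∞ := by
    refine ne_top_of_le_ne_top ?_ (ENNReal.tsum_le_tsum hlt)
    rw [ENNReal.tsum_geometric]
    exact ENNReal.inv_ne_top.2 (tsub_pos_of_lt ht1).ne'
  filter_upwards [ae_eventually_notMem hsum] with d hd
  filter_upwards [hd] with n hn
  simp only [not_le] at hn
  exact hn.le

theorem lintegral_infinitePi_prod {E : Type*} [MeasurableSpace E] (P₀ : Measure E)
    [IsProbabilityMeasure P₀] {g : E → ℝ≥0∞} (hg : Measurable g) (n : ℕ) :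
    ∫⁻ d, ∏ i ∈ Finset.range n, g (d i) ∂(Measure.infinitePi fun _ : ℕ => P₀) =
      (∫⁻ e, g e ∂P₀) ^ n := by
  have hind : iIndepFun (fun (i : ℕ) (d : ℕ → E) => g (d i)) (Measure.infinitePi fun _ => P₀) :=
    iIndepFun_infinitePi (P := fun _ : ℕ => P₀) (X := fun _ => g) fun _ => hg
  have := lintegral_prod_eq_prod_lintegral_of_indepFun (Finset.range n) _ hind
    (fun i => hg.comp (measurable_pi_apply i))
  rw [this]
  have h2 : ∀ i, ∫⁻ d : ℕ → E, g (d i) ∂(Measure.infinitePi fun _ : ℕ => P₀) =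
      ∫⁻ e, g e ∂P₀ := fun i => by
    conv_rhs => rw [← (measurePreserving_eval_infinitePi (fun _ : ℕ => P₀) i).map_eq]
    rw [lintegral_map hg (measurable_pi_apply i)]
  simp [h2]

theorem prod_eq_prod_mul_prod_div {Ω E : Type*} {H : Ω → E → ℝ≥0∞} {h₀ : E → ℝ≥0∞}
    {d : ℕ → E} (hd0 : ∀ i, h₀ (d i) ≠ 0)
    (hdT : ∀ e, h₀ e ≠ ∞) (ω : Ω) (n : ℕ) :
    ∏ i ∈ Finset.range n, H ω (d i) =
      (∏ i ∈ Finset.range n, h₀ (d i)) * ∏ i ∈ Finset.range n, (H ω (d i) / h₀ (d i)) := by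
  rw [← Finset.prod_mul_distrib]
  exact Finset.prod_congr rfl fun i _ => (ENNReal.mul_div_cancel (hd0 i) (hdT _)).symm

section Schwartz

variable {Ω E : Type*} [MeasurableSpace Ω] [MeasurableSpace E] {P : Measure Ω} {μ : Measure E}
  {H : Ω → E → ℝ≥0∞} {h₀ : E → ℝ≥0∞}

/-- Expectation, under the true law, of the likelihood ratio tilted by `w` and averaged over the
parameters in `A`. -/
theorem lintegral_ratio_le [IsProbabilityMeasure P] [SigmaFinite μ]
    (hH : Measurable (Function.uncurry H)) (hh₀ : Measurable h₀)
    [IsProbabilityMeasure (μ.withDensity h₀)] {w : E → ℝ≥0∞} (hw : Measurable w) {s : ℝ≥0∞}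
    {A : Set Ω} (hA : MeasurableSet A) (hs : ∀ᵐ ω ∂P, ω ∈ A → ∫⁻ e, w e * H ω e ∂μ ≤ s) (n : ℕ) :
    ∫⁻ d, ∫⁻ ω in A, ∏ i ∈ Finset.range n, (H ω (d i) / h₀ (d i) * w (d i)) ∂P
      ∂(Measure.infinitePi fun _ : ℕ => μ.withDensity h₀) ≤ s ^ n := by
  have hm : ∀ i : ℕ, Measurable fun z : (ℕ → E) × Ω =>
      H z.2 (z.1 i) / h₀ (z.1 i) * w (z.1 i) := by
    intro i
    have hi : Measurable fun z : (ℕ → E) × Ω => z.1 i :=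
      (measurable_pi_apply i).comp measurable_fst
    have h1 : Measurable fun z : (ℕ → E) × Ω => H z.2 (z.1 i) :=
      hH.comp (measurable_snd.prodMk hi)
    exact (h1.div (hh₀.comp hi)).mul (hw.comp hi)
  rw [lintegral_lintegral_swap (Finset.measurable_fun_prod _ fun i _ => hm i).aemeasurable]
  have hinner : ∀ᵐ ω ∂(P.restrict A),
      ∫⁻ d, ∏ i ∈ Finset.range n, (H ω (d i) / h₀ (d i) * w (d i))
        ∂(Measure.infinitePi fun _ : ℕ => μ.withDensity h₀) ≤ s ^ n := by
    rw [ae_restrict_iff' hA]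
    filter_upwards [hs] with ω hω hωA
    have hHω : Measurable (H ω) := hH.comp measurable_prodMk_left
    rw [lintegral_infinitePi_prod _ (g := fun e => H ω e / h₀ e * w e)
      ((hHω.div hh₀).mul hw)]
    refine pow_le_pow_left' (le_trans ?_ (hω hωA)) n
    rw [lintegral_withDensity_eq_lintegral_mul _ hh₀
      (g := fun e => H ω e / h₀ e * w e) ((hHω.div hh₀).mul hw)]
    refine lintegral_mono fun e => ?_
    simp only [Pi.mul_apply]
    calc h₀ e * (H ω e / h₀ e * w e) = (h₀ e * (H ω e / h₀ e)) * w e := by ring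
      _ ≤ H ω e * w e := mul_le_mul_left ENNReal.mul_div_le _
      _ = w e * H ω e := mul_comm _ _
  calc _ ≤ ∫⁻ _ in A, s ^ n ∂P := lintegral_mono_ae hinner
    _ ≤ s ^ n := by
      rw [lintegral_const, Measure.restrict_apply_univ]
      exact mul_le_of_le_one_right' prob_le_one

/-- The prior puts enough mass near the true density `h₀`: up to any geometric factor, the
marginal likelihood dominates the true likelihood, for all data. -/
def DominatesTruth (P : Measure Ω) (H : Ω → E → ℝ≥0∞) (h₀ : E → ℝ≥0∞) : Prop :=
  ∀ t : ℝ≥0∞, t < 1 → ∃ c : ℝ≥0∞, c ≠ 0 ∧ c ≠ ∞ ∧ ∀ (n : ℕ) (d : ℕ → E),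
    c * t ^ n * ∏ i ∈ Finset.range n, h₀ (d i) ≤ ∫⁻ ω, ∏ i ∈ Finset.range n, H ω (d i) ∂P

theorem ae_infinitePi_density_ne_zero (hh₀ : Measurable h₀)
    [IsProbabilityMeasure (μ.withDensity h₀)] :
    ∀ᵐ d ∂(Measure.infinitePi fun _ : ℕ => μ.withDensity h₀), ∀ i, h₀ (d i) ≠ 0 := by
  rw [ae_all_iff]
  intro i
  have h1 : ∀ᵐ e ∂(μ.withDensity h₀), h₀ e ≠ 0 := by
    rw [ae_withDensity_iff hh₀]
    exact ae_of_all _ fun e he => he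
  exact (measurePreserving_eval_infinitePi
    (fun _ : ℕ => μ.withDensity h₀) i).quasiMeasurePreserving.ae h1

/-- The parameters that are separated from the truth by the exponential test `∏ w(d_i)` have
asymptotically negligible posterior mass. -/
theorem ae_tendsto_posterior_zero [IsProbabilityMeasure P] [SigmaFinite μ]
    (hH : Measurable (Function.uncurry H)) (hh₀ : Measurable h₀) (hh₀T : ∀ e, h₀ e ≠ ∞)
    [IsProbabilityMeasure (μ.withDensity h₀)] (hdom : DominatesTruth P H h₀)
    {w : E → ℝ≥0∞} (hw : Measurable w) (hw0 : ∀ e, w e ≠ 0) (hwT : ∀ e, w e ≠ ∞)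
    {t : ℝ≥0∞} (ht0 : t ≠ 0) (ht1 : t < 1)
    (hwP : ∫⁻ e, w e ∂(μ.withDensity h₀) ≤ t * t) :
    ∀ᵐ d ∂(Measure.infinitePi fun _ : ℕ => μ.withDensity h₀),
      Tendsto (fun n : ℕ => posterior P (fun ω => ∏ i ∈ Finset.range n, H ω (d i))
        {ω | ∫⁻ e, (w e)⁻¹ * H ω e ∂μ ≤ t * t}) atTop (𝓝 0) := by
  set A : Set Ω := {ω | ∫⁻ e, (w e)⁻¹ * H ω e ∂μ ≤ t * t} with hAdef
  have hA : MeasurableSet A := by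
    have : Measurable fun ω => ∫⁻ e, (w e)⁻¹ * H ω e ∂μ :=
      Measurable.lintegral_prod_right' (f := fun z : Ω × E => (w z.2)⁻¹ * H z.1 z.2)
        ((hw.comp measurable_snd).inv.mul hH)
    exact this measurableSet_Iic
  obtain ⟨c, hc0, hcT, hc⟩ := hdom t ht1
  have hX := ae_eventually_le_pow (Q := Measure.infinitePi fun _ : ℕ => μ.withDensity h₀)
    (Y := fun n d => ∏ i ∈ Finset.range n, w (d i))
    (fun n => (Finset.measurable_fun_prod _ fun i _ =>
      hw.comp (measurable_pi_apply i)).aemeasurable) ht0 ht1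
    (fun n => by
      rw [lintegral_infinitePi_prod _ hw]
      exact pow_le_pow_left' hwP n)
  have hYm : ∀ n : ℕ, Measurable fun d : ℕ → E =>
      ∫⁻ ω in A, ∏ i ∈ Finset.range n, (H ω (d i) / h₀ (d i) * (w (d i))⁻¹) ∂P := by
    intro n
    refine Measurable.lintegral_prod_right' (f := fun z : (ℕ → E) × Ω =>
      ∏ i ∈ Finset.range n, (H z.2 (z.1 i) / h₀ (z.1 i) * (w (z.1 i))⁻¹)) ?_
    refine Finset.measurable_fun_prod _ fun i _ => ?_
    have hi : Measurable fun z : (ℕ → E) × Ω => z.1 i :=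
      (measurable_pi_apply i).comp measurable_fst
    have h1 : Measurable fun z : (ℕ → E) × Ω => H z.2 (z.1 i) :=
      hH.comp (measurable_snd.prodMk hi)
    exact (h1.div (hh₀.comp hi)).mul (hw.comp hi).inv
  have hY := ae_eventually_le_pow (Q := Measure.infinitePi fun _ : ℕ => μ.withDensity h₀)
    (fun n => (hYm n).aemeasurable) ht0 ht1
    (fun n => lintegral_ratio_le (P := P) hH hh₀ hw.inv hA (ae_of_all _ fun ω hω => hω) n)
  filter_upwards [hX, hY, ae_infinitePi_density_ne_zero hh₀] with d hdX hdY hd0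
  have hlim : Tendsto (fun n : ℕ => c⁻¹ * t ^ n) atTop (𝓝 0) := by
    have := ENNReal.Tendsto.const_mul (a := c⁻¹) (ENNReal.tendsto_pow_atTop_nhds_zero_of_lt_one ht1)
      (Or.inr (ENNReal.inv_ne_top.2 hc0))
    simpa using this
  refine tendsto_of_tendsto_of_tendsto_of_le_of_le' tendsto_const_nhds hlim
    (Eventually.of_forall fun n => zero_le) ?_
  filter_upwards [hdX, hdY] with n hnX hnY
  set K := ∏ i ∈ Finset.range n, h₀ (d i)
  have hK0 : K ≠ 0 := Finset.prod_ne_zero_iff.2 fun i _ => hd0 i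
  have hKT : K ≠ ∞ := ENNReal.prod_ne_top fun i _ => hh₀T _
  have htT : t ^ n ≠ ∞ := ENNReal.pow_ne_top ht1.ne_top
  have hm1 : Measurable fun ω => ∏ i ∈ Finset.range n, (H ω (d i) / h₀ (d i)) :=
    Finset.measurable_fun_prod _ fun i _ =>
      ((hH.comp (measurable_id.prodMk measurable_const)).div measurable_const)
  have hm2 : Measurable fun ω =>
      ∏ i ∈ Finset.range n, (H ω (d i) / h₀ (d i) * (w (d i))⁻¹) :=
    Finset.measurable_fun_prod _ fun i _ =>
      ((hH.comp (measurable_id.prodMk measurable_const)).div measurable_const).mul measurable_const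
  have hnum : ∫⁻ ω in A, ∏ i ∈ Finset.range n, H ω (d i) ∂P ≤ K * (t ^ n * t ^ n) := by
    simp_rw [prod_eq_prod_mul_prod_div hd0 hh₀T]
    rw [lintegral_const_mul _ hm1]
    refine mul_le_mul_right ?_ K
    calc ∫⁻ ω in A, ∏ i ∈ Finset.range n, (H ω (d i) / h₀ (d i)) ∂P
        = ∫⁻ ω in A, (∏ i ∈ Finset.range n, w (d i)) *
            ∏ i ∈ Finset.range n, (H ω (d i) / h₀ (d i) * (w (d i))⁻¹) ∂P := by
          refine lintegral_congr fun ω => ?_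
          rw [← Finset.prod_mul_distrib]
          refine Finset.prod_congr rfl fun i _ => ?_
          rw [mul_comm, mul_assoc, ENNReal.inv_mul_cancel (hw0 _) (hwT _), mul_one]
      _ = (∏ i ∈ Finset.range n, w (d i)) *
            ∫⁻ ω in A, ∏ i ∈ Finset.range n, (H ω (d i) / h₀ (d i) * (w (d i))⁻¹) ∂P :=
          lintegral_const_mul _ hm2
      _ ≤ t ^ n * t ^ n := mul_le_mul' hnX hnY
  unfold posterior
  refine (ENNReal.div_le_div hnum (hc n d)).trans ?_
  refine ENNReal.div_le_of_le_mul' ?_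
  calc K * (t ^ n * t ^ n) = c * c⁻¹ * (K * (t ^ n * t ^ n)) := by
        rw [ENNReal.mul_inv_cancel hc0 hcT, one_mul]
    _ ≤ c * t ^ n * K * (c⁻¹ * t ^ n) := le_of_eq (by ring)

end Schwartz
section Consistency

variable {Ω E : Type*} [MeasurableSpace Ω] [MeasurableSpace E] {P : Measure Ω} {μ : Measure E}

theorem posterior_mono (L : Ω → ℝ≥0∞) {A B : Set Ω} (h : A ≤ᵐ[P] B) :
    posterior P L A ≤ posterior P L B :=
  ENNReal.div_le_div_right (lintegral_mono' (Measure.restrict_mono' h le_rfl) le_rfl) _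

theorem posterior_mono_set (L : Ω → ℝ≥0∞) {A B : Set Ω} (h : A ⊆ B) :
    posterior P L A ≤ posterior P L B :=
  ENNReal.div_le_div_right (lintegral_mono' (Measure.restrict_mono h le_rfl) le_rfl) _

theorem posterior_union_le (L : Ω → ℝ≥0∞) (A B : Set Ω) :
    posterior P L (A ∪ B) ≤ posterior P L A + posterior P L B := by
  unfold posterior
  rw [← ENNReal.add_div]
  exact ENNReal.div_le_div_right (lintegral_union_le _ _ _) _

theorem posterior_le_one (L : Ω → ℝ≥0∞) (A : Set Ω) : posterior P L A ≤ 1 :=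
  ENNReal.div_le_of_le_mul (by rw [one_mul]; exact setLIntegral_le_lintegral _ _)

theorem one_le_posterior_univ {L : Ω → ℝ≥0∞} (h0 : ∫⁻ ω, L ω ∂P ≠ 0) (hT : ∫⁻ ω, L ω ∂P ≠ ∞) :
    1 ≤ posterior P L Set.univ := by
  simp [posterior, ENNReal.div_self h0 hT]

/-- Parameters for which `∫ f` exceeds its true value by a fixed amount have asymptotically
negligible posterior mass.  The test separating them from the truth is the exponential of a small
multiple of the centered function `f`. -/
theorem ae_tendsto_posterior_integral_ge [IsProbabilityMeasure P] [SigmaFinite μ]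
    {H : Ω → E → ℝ≥0∞} {h₀ : E → ℝ≥0∞}
    (hH : Measurable (Function.uncurry H)) (hh₀ : Measurable h₀) (hh₀T : ∀ e, h₀ e ≠ ∞)
    [IsProbabilityMeasure (μ.withDensity h₀)] (hdom : DominatesTruth P H h₀)
    {f : E → ℝ} (hf : Measurable f) {C : ℝ} (hfC : ∀ e, |f e| ≤ C) {ε : ℝ} (hε : 0 < ε) :
    ∀ᵐ d ∂(Measure.infinitePi fun _ : ℕ => μ.withDensity h₀),
      Tendsto (fun n : ℕ => posterior P (fun ω => ∏ i ∈ Finset.range n, H ω (d i))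
        {ω | IsProbabilityMeasure (μ.withDensity (H ω)) ∧
          ∫ e, f e ∂(μ.withDensity h₀) + ε ≤ ∫ e, f e ∂(μ.withDensity (H ω))}) atTop (𝓝 0) := by
  have hint : ∀ (Q : Measure E) [IsProbabilityMeasure Q], Integrable f Q := fun Q _ =>
    Integrable.of_bound hf.aestronglyMeasurable C (ae_of_all _ hfC)
  set b : ℝ := ∫ e, f e ∂(μ.withDensity h₀) with hb
  have hbC : |b| ≤ C := by
    have := norm_integral_le_of_norm_le_const (μ := μ.withDensity h₀) (f := f) (C := C)
      (ae_of_all _ hfC)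
    simpa using this
  set u : E → ℝ := fun e => f e - (b + ε / 2) with hu
  have hum : Measurable u := hf.sub measurable_const
  have hC0 : 0 ≤ C := (abs_nonneg b).trans hbC
  set K : ℝ := 2 * C + ε with hK
  have hK0 : 0 < K := by positivity
  have huK : ∀ e, |u e| ≤ K := by
    intro e
    have h1 := abs_le.1 (hfC e)
    have h2 := abs_le.1 hbC
    rw [abs_le]
    constructor <;> simp only [hu, hK] <;> linarith [h1.1, h1.2, h2.1, h2.2]
  have hnegK : ∀ e, |(-u e)| ≤ K := fun e => by rw [abs_neg]; exact huK e
  have hmean : ∀ (Q : Measure E) [IsProbabilityMeasure Q],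
      ∫ e, u e ∂Q = ∫ e, f e ∂Q - (b + ε / 2) := by
    intro Q _
    simp only [hu]
    rw [integral_sub (hint Q) (integrable_const _)]
    simp
  -- `l` is small enough for the second-order bound of `lintegral_exp_le`
  set l : ℝ := min (1 / K) (ε / 4 / K ^ 2) with hl
  have hl0 : 0 < l := lt_min (by positivity) (by positivity)
  have hlK : l * K ≤ 1 := by
    calc l * K ≤ 1 / K * K := mul_le_mul_of_nonneg_right (min_le_left _ _) hK0.le
      _ = 1 := by field_simp
  have hlK2 : l * K ^ 2 ≤ ε / 2 / 2 := by
    calc l * K ^ 2 ≤ ε / 4 / K ^ 2 * K ^ 2 :=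
          mul_le_mul_of_nonneg_right (min_le_right _ _) (by positivity)
      _ = ε / 2 / 2 := by field_simp; norm_num
  set t : ℝ≥0∞ := ENNReal.ofReal (Real.exp (-(l * (ε / 2) / 2) / 2)) with ht
  have htt : t * t = ENNReal.ofReal (Real.exp (-(l * (ε / 2) / 2))) := by
    rw [ht, ← ENNReal.ofReal_mul (Real.exp_pos _).le, ← Real.exp_add]
    congr 2
    ring
  have ht0 : t ≠ 0 := (ENNReal.ofReal_pos.2 (Real.exp_pos _)).ne'
  have ht1 : t < 1 := by
    rw [ht, ENNReal.ofReal_lt_one, Real.exp_lt_one_iff]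
    have : 0 < l * (ε / 2) := by positivity
    linarith
  have hwm : Measurable fun e => ENNReal.ofReal (Real.exp (l * u e)) :=
    (hum.const_mul l).exp.ennreal_ofReal
  have key := ae_tendsto_posterior_zero (P := P) (μ := μ) hH hh₀ hh₀T hdom hwm
    (fun e => (ENNReal.ofReal_pos.2 (Real.exp_pos _)).ne') (fun e => ENNReal.ofReal_ne_top)
    ht0 ht1 (by
      rw [htt]
      refine lintegral_exp_le hl0 hlK hlK2 _ hum huK ?_
      rw [hmean]
      linarith)
  filter_upwards [key] with d hd
  refine tendsto_of_tendsto_of_tendsto_of_le_of_le tendsto_const_nhds hd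
    (fun n => zero_le) fun n => ?_
  refine posterior_mono_set _ ?_
  rintro ω ⟨hω, hge⟩
  have hHω : Measurable (H ω) := hH.comp measurable_prodMk_left
  show ∫⁻ e, (ENNReal.ofReal (Real.exp (l * u e)))⁻¹ * H ω e ∂μ ≤ t * t
  have hinv : ∀ e, (ENNReal.ofReal (Real.exp (l * u e)))⁻¹ =
      ENNReal.ofReal (Real.exp (l * -u e)) := fun e => by
    rw [← ENNReal.ofReal_inv_of_pos (Real.exp_pos _), ← Real.exp_neg, mul_neg]
  simp_rw [hinv]
  have h1 := lintegral_exp_le (η := ε / 2) hl0 hlK hlK2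
    (μ.withDensity (H ω)) hum.neg hnegK (by
      simp only [Pi.neg_apply]
      rw [integral_neg, hmean]
      linarith)
  rw [htt]
  refine le_trans (le_of_eq ?_) h1
  rw [lintegral_withDensity_eq_lintegral_mul _ hHω
    (hum.neg.const_mul l).exp.ennreal_ofReal]
  refine lintegral_congr fun e => ?_
  simp [mul_comm]

/-- **Schwartz's theorem** for weak neighborhoods: if the prior dominates the truth, the posterior
is weakly consistent. -/
theorem posteriorWeaklyConsistentAt_of_dominatesTruth [TopologicalSpace E]
    [TopologicalSpace.PseudoMetrizableSpace E] [TopologicalSpace.SeparableSpace E] [BorelSpace E]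
    [IsProbabilityMeasure P] [SigmaFinite μ] {h : Ω → E → ℝ} {h₀ : E → ℝ≥0∞}
    (hH : Measurable (Function.uncurry fun ω e => ENNReal.ofReal (h ω e)))
    (hh₀ : Measurable h₀) (hh₀T : ∀ e, h₀ e ≠ ∞) {P₀ : ProbabilityMeasure E}
    (hP₀ : (P₀ : Measure E) = μ.withDensity h₀)
    (hprob : ∀ᵐ ω ∂P, ∫⁻ e, ENNReal.ofReal (h ω e) ∂μ = 1)
    (hdom : DominatesTruth P (fun ω e => ENNReal.ofReal (h ω e)) h₀) :
    PosteriorWeaklyConsistentAt P μ h P₀ := by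
  set H : Ω → E → ℝ≥0∞ := fun ω e => ENNReal.ofReal (h ω e) with hHdef
  have hprobP₀ : IsProbabilityMeasure (μ.withDensity h₀) := hP₀ ▸ P₀.2
  have hprobH : ∀ᵐ ω ∂P, IsProbabilityMeasure (μ.withDensity (H ω)) := by
    filter_upwards [hprob] with ω hω
    exact ⟨by rw [withDensity_apply _ MeasurableSet.univ, Measure.restrict_univ]; exact hω⟩
  set Q := Measure.infinitePi fun _ : ℕ => μ.withDensity h₀ with hQ
  let L : (ℕ → E) → ℕ → Ω → ℝ≥0∞ := fun d n ω => ∏ i ∈ Finset.range n, H ω (d i)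
  let bad : Set (ProbabilityMeasure E) → Set Ω := fun U =>
    {ω | ∃ R ∈ U, (R : Measure E) = μ.withDensity (H ω)}ᶜ
  -- the sets of laws whose complement is asymptotically negligible form a filter
  let G : Filter (ProbabilityMeasure E) :=
    { sets := {U | ∀ᵐ d ∂Q, Tendsto (fun n => posterior P (L d n) (bad U)) atTop (𝓝 0)}
      univ_sets := by
        refine ae_of_all _ fun d => ?_
        have hz : ∀ n, posterior P (L d n) (bad Set.univ) = 0 := by
          intro n
          have : P (bad Set.univ) = 0 := by
            refine measure_mono_null ?_ (ae_iff.1 hprobH)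
            intro ω hω hpr
            exact hω ⟨⟨μ.withDensity (H ω), hpr⟩, Set.mem_univ _, rfl⟩
          simp [posterior, Measure.restrict_eq_zero.2 this]
        simp [hz]
      sets_of_superset := by
        intro U V hU hUV
        change ∀ᵐ d ∂Q, Tendsto (fun n => posterior P (L d n) (bad V)) atTop (𝓝 0)
        filter_upwards [hU] with d hd
        refine tendsto_of_tendsto_of_tendsto_of_le_of_le tendsto_const_nhds hd
          (fun n => zero_le) fun n => posterior_mono_set _ ?_
        exact Set.compl_subset_compl.2 fun ω ⟨R, hR, h⟩ => ⟨R, hUV hR, h⟩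
      inter_sets := by
        intro U V hU hV
        change ∀ᵐ d ∂Q, Tendsto (fun n => posterior P (L d n) (bad (U ∩ V))) atTop (𝓝 0)
        filter_upwards [hU, hV] with d hdU hdV
        have hsum := hdU.add hdV
        rw [add_zero] at hsum
        refine tendsto_of_tendsto_of_tendsto_of_le_of_le tendsto_const_nhds hsum
          (fun n => zero_le) fun n => (posterior_mono_set _ ?_).trans
            (posterior_union_le _ _ _)
        intro ω hω
        by_contra hcon
        simp only [bad, Set.mem_union, Set.mem_compl_iff, not_or, not_not] at hcon
        obtain ⟨⟨R, hR, hRe⟩, ⟨R', hR', hRe'⟩⟩ := hcon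
        have : R = R' := Subtype.ext (hRe.trans hRe'.symm)
        exact hω ⟨R, ⟨hR, this ▸ hR'⟩, hRe⟩ }
  have hG : G ≤ 𝓝 P₀ := by
    rw [nhds_probabilityMeasure_eq_iInf]
    refine le_iInf fun f => ?_
    rw [← tendsto_iff_comap, Metric.tendsto_nhds]
    intro ε hε
    show ∀ᵐ d ∂Q, Tendsto (fun n => posterior P (L d n) (bad _)) atTop (𝓝 0)
    have hfC : ∀ e, |f e| ≤ ‖f‖ := fun e => f.norm_coe_le_norm e
    have h1 := ae_tendsto_posterior_integral_ge (P := P) (μ := μ) hH hh₀ hh₀T hdom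
      f.continuous.measurable hfC hε
    have h2 := ae_tendsto_posterior_integral_ge (P := P) (μ := μ) hH hh₀ hh₀T hdom
      f.continuous.measurable.neg (C := ‖f‖)
      (fun e => by rw [Pi.neg_apply, abs_neg]; exact hfC e) hε
    filter_upwards [h1, h2] with d hd1 hd2
    have hsum := hd1.add hd2
    rw [add_zero] at hsum
    refine tendsto_of_tendsto_of_tendsto_of_le_of_le tendsto_const_nhds hsum
      (fun n => zero_le) fun n => (posterior_mono _ ?_).trans (posterior_union_le _ _ _)
    filter_upwards [hprobH] with ω hpr hω
    by_contra hunion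
    have hcon := not_or.1 hunion
    refine hω ⟨⟨μ.withDensity (H ω), hpr⟩, ?_, rfl⟩
    have hc1 : ¬ (∫ e, f e ∂(μ.withDensity h₀) + ε ≤ ∫ e, f e ∂(μ.withDensity (H ω))) :=
      fun hle => hcon.1 ⟨hpr, hle⟩
    have hc2 : ¬ (∫ e, -f e ∂(μ.withDensity h₀) + ε ≤ ∫ e, -f e ∂(μ.withDensity (H ω))) :=
      fun hle => hcon.2 ⟨hpr, hle⟩
    rw [integral_neg, integral_neg] at hc2
    show dist (∫ e, f e ∂(μ.withDensity (H ω))) (∫ e, f e ∂(P₀ : Measure E)) < ε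
    rw [hP₀, Real.dist_eq, abs_lt]
    constructor <;> linarith
  -- the evidence is finite and nonzero for almost every sample
  have hfin : ∀ᵐ d ∂Q, ∀ n, ∫⁻ ω, L d n ω ∂P ≠ 0 ∧ ∫⁻ ω, L d n ω ∂P ≠ ∞ := by
    rw [ae_all_iff]
    intro n
    have hE := lintegral_ratio_le (P := P) (μ := μ) (w := fun _ => 1) hH hh₀ measurable_const
      MeasurableSet.univ (s := 1) (by
        filter_upwards [hprob] with ω hω _
        simpa using hω.le) n
    have hae := ae_lt_top' (μ := Q) (f := fun d => ∫⁻ ω in Set.univ,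
      ∏ i ∈ Finset.range n, (H ω (d i) / h₀ (d i) * 1) ∂P) (by
        refine (Measurable.lintegral_prod_right' (f := fun z : (ℕ → E) × Ω =>
          ∏ i ∈ Finset.range n, (H z.2 (z.1 i) / h₀ (z.1 i) * 1)) ?_).aemeasurable
        refine Finset.measurable_fun_prod _ fun i _ => ?_
        have hi : Measurable fun z : (ℕ → E) × Ω => z.1 i :=
          (measurable_pi_apply i).comp measurable_fst
        have h1 : Measurable fun z : (ℕ → E) × Ω => H z.2 (z.1 i) :=
          hH.comp (measurable_snd.prodMk hi)
        exact (h1.div (hh₀.comp hi)).mul measurable_const)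
      (ne_top_of_le_ne_top (by simp) hE)
    obtain ⟨c, hc0, -, hc⟩ := hdom (1 / 2) (by simp)
    filter_upwards [hae, ae_infinitePi_density_ne_zero (μ := μ) hh₀] with d hdlt hd0
    constructor
    · have hpos : 0 < c * (1 / 2) ^ n * ∏ i ∈ Finset.range n, h₀ (d i) := by
        refine pos_iff_ne_zero.2 (mul_ne_zero (mul_ne_zero hc0 (pow_ne_zero _ (by simp))) ?_)
        exact Finset.prod_ne_zero_iff.2 fun i _ => hd0 i
      exact (hpos.trans_le (hc n d)).ne'
    · simp only [L]
      simp_rw [prod_eq_prod_mul_prod_div hd0 hh₀T]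
      have hm1 : Measurable fun ω => ∏ i ∈ Finset.range n, (H ω (d i) / h₀ (d i)) :=
        Finset.measurable_fun_prod _ fun i _ =>
          ((hH.comp (measurable_id.prodMk measurable_const)).div measurable_const)
      rw [lintegral_const_mul _ hm1]
      refine ENNReal.mul_ne_top (ENNReal.prod_ne_top fun i _ => hh₀T _) ?_
      simpa using hdlt.ne
  obtain ⟨B, hB⟩ := (𝓝 P₀).exists_antitone_basis
  have hBae : ∀ᵐ d ∂Q, ∀ j, Tendsto (fun n => posterior P (L d n) (bad (B j))) atTop (𝓝 0) :=
    ae_all_iff.2 fun j => hG (hB.1.mem_of_mem trivial)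
  unfold PosteriorWeaklyConsistentAt
  rw [hP₀]
  filter_upwards [hBae, hfin] with d hd hdfin U hU
  obtain ⟨j, -, hj⟩ := hB.1.mem_iff.1 hU
  have hlow : ∀ n, 1 - posterior P (L d n) (bad (B j)) ≤
      posterior P (L d n) {ω | ∃ R ∈ U, (R : Measure E) = densityMeasure μ (h ω)} := by
    intro n
    rw [tsub_le_iff_right]
    refine (one_le_posterior_univ (hdfin n).1 (hdfin n).2).trans ?_
    refine (posterior_mono_set _ ?_).trans (posterior_union_le _ _ _)
    intro ω _
    by_cases hω : ω ∈ bad (B j)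
    · exact Or.inr hω
    · simp only [bad, Set.mem_compl_iff, not_not] at hω
      obtain ⟨R, hR, hRe⟩ := hω
      exact Or.inl ⟨R, hj hR, hRe⟩
  have hlim : Tendsto (fun n => 1 - posterior P (L d n) (bad (B j))) atTop (𝓝 1) := by
    have := ENNReal.Tendsto.sub (tendsto_const_nhds (x := (1 : ℝ≥0∞)) (f := atTop)) (hd j)
      (Or.inl ENNReal.one_ne_top)
    simpa using this
  exact tendsto_of_tendsto_of_tendsto_of_le_of_le hlim tendsto_const_nhds hlow
    fun n => posterior_le_one _ _

end Consistency

/-! ### The Dirichlet integral -/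

theorem lintegral_beta_scaled {a b s : ℝ} (ha : 0 < a) (hb : 0 < b) (hs : 0 < s) :
    ∫⁻ t in Set.Ioo 0 s, ENNReal.ofReal (t ^ (a - 1) * (s - t) ^ (b - 1)) =
      ENNReal.ofReal (Real.Gamma a * Real.Gamma b / Real.Gamma (a + b) * s ^ (a + b - 1)) := by
  have hB : 0 < ProbabilityTheory.beta a b := beta_pos ha hb
  have hBe : ProbabilityTheory.beta a b = Real.Gamma a * Real.Gamma b / Real.Gamma (a + b) := rfl
  rw [← hBe, ← lintegral_indicator measurableSet_Ioo]
  have hfm : Measurable ((Set.Ioo 0 s).indicator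
      fun t : ℝ => ENNReal.ofReal (t ^ (a - 1) * (s - t) ^ (b - 1))) :=
    Measurable.indicator (by fun_prop) measurableSet_Ioo
  have hmap := Real.map_volume_mul_left hs.ne'
  have h1 : ∫⁻ u : ℝ, (Set.Ioo 0 s).indicator
        (fun t : ℝ => ENNReal.ofReal (t ^ (a - 1) * (s - t) ^ (b - 1))) (s * u) =
      ENNReal.ofReal s⁻¹ * ∫⁻ t : ℝ, (Set.Ioo 0 s).indicator
        (fun t : ℝ => ENNReal.ofReal (t ^ (a - 1) * (s - t) ^ (b - 1))) t := by
    rw [← lintegral_map hfm (measurable_const_mul s), hmap, lintegral_smul_measure,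
      abs_of_pos (inv_pos.2 hs), smul_eq_mul]
  have h2 : ∀ u : ℝ, (Set.Ioo 0 s).indicator
        (fun t : ℝ => ENNReal.ofReal (t ^ (a - 1) * (s - t) ^ (b - 1))) (s * u) =
      ENNReal.ofReal (s ^ (a + b - 2) * ProbabilityTheory.beta a b) * betaPDF a b u := by
    intro u
    rw [betaPDF_eq]
    by_cases hu : 0 < u ∧ u < 1
    · have hmem : s * u ∈ Set.Ioo 0 s := ⟨mul_pos hs hu.1, by nlinarith [hu.2]⟩
      rw [Set.indicator_of_mem hmem, if_pos hu, ← ENNReal.ofReal_mul (by positivity)]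
      congr 1
      have e1 : s - s * u = s * (1 - u) := by ring
      rw [e1, Real.mul_rpow hs.le hu.1.le, Real.mul_rpow hs.le (by linarith [hu.2]),
        show a + b - 2 = (a - 1) + (b - 1) by ring, Real.rpow_add hs]
      field_simp
    · have hmem : s * u ∉ Set.Ioo 0 s := fun h => hu
        ⟨pos_of_mul_pos_right h.1 hs.le, by
          by_contra hcon
          have := h.2
          nlinarith⟩
      rw [Set.indicator_of_notMem hmem, if_neg hu]
      simp
  simp_rw [h2] at h1
  rw [lintegral_const_mul' _ _ ENNReal.ofReal_ne_top,
    lintegral_betaPDF_eq_one ha hb, mul_one] at h1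
  have h3 : ENNReal.ofReal s * ENNReal.ofReal s⁻¹ = 1 := by
    rw [← ENNReal.ofReal_mul hs.le, mul_inv_cancel₀ hs.ne', ENNReal.ofReal_one]
  calc _ = ENNReal.ofReal s * (ENNReal.ofReal s⁻¹ * ∫⁻ t : ℝ, (Set.Ioo 0 s).indicator
        (fun t : ℝ => ENNReal.ofReal (t ^ (a - 1) * (s - t) ^ (b - 1))) t) := by
        rw [← mul_assoc, h3, one_mul]
    _ = _ := by
        rw [← h1, ← ENNReal.ofReal_mul hs.le, ← mul_assoc, mul_comm (ProbabilityTheory.beta a b)]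
        congr 2
        rw [show a + b - 1 = (a + b - 2) + 1 by ring, Real.rpow_add_one hs.ne']
        ring

/-- The Dirichlet integral over the simplex of size `s`, by induction on the dimension: integrating
out all but the first coordinate leaves a Beta integral. -/
theorem lintegral_dirichlet_kernel (m : ℕ) (α : Fin m → ℝ) (hα : ∀ i, 0 < α i) {γ : ℝ} (hγ : 0 < γ)
    {s : ℝ} (hs : 0 < s) :
    ∫⁻ y : Fin m → ℝ, {y : Fin m → ℝ | (∀ i, 0 ≤ y i) ∧ ∑ i, y i ≤ s}.indicator
        (fun y => ENNReal.ofReal ((∏ i, y i ^ (α i - 1)) * (s - ∑ i, y i) ^ (γ - 1))) y =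
      ENNReal.ofReal ((∏ i, Real.Gamma (α i)) * Real.Gamma γ / Real.Gamma (∑ i, α i + γ) *
        s ^ (∑ i, α i + γ - 1)) := by
  induction m generalizing s with
  | zero =>
    rw [lintegral_unique]
    have hG : Real.Gamma γ ≠ 0 := (Real.Gamma_pos_of_pos hγ).ne'
    have hv : (volume : Measure (Fin 0 → ℝ)) Set.univ = 1 := by
      rw [volume_pi, Measure.pi_univ]
      simp
    rw [Set.indicator_of_mem (by simp [hs.le])]
    simp [hv, hG]
  | succ m ih =>
    have hmeas : ∀ n : ℕ, MeasurableSet {y : Fin n → ℝ | (∀ i, 0 ≤ y i) ∧ ∑ i, y i ≤ s} := by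
      intro n
      have h1 : IsClosed {y : Fin n → ℝ | ∀ i, 0 ≤ y i} := by
        simp only [Set.ofPred_forall]
        exact isClosed_iInter fun i => isClosed_le continuous_const (continuous_apply i)
      have h2 : IsClosed {y : Fin n → ℝ | ∑ i, y i ≤ s} :=
        isClosed_le (by fun_prop) continuous_const
      exact (h1.inter h2).measurableSet
    set f : (Fin (m + 1) → ℝ) → ℝ≥0∞ :=
      {y : Fin (m + 1) → ℝ | (∀ i, 0 ≤ y i) ∧ ∑ i, y i ≤ s}.indicator
        (fun y => ENNReal.ofReal ((∏ i, y i ^ (α i - 1)) * (s - ∑ i, y i) ^ (γ - 1))) with hf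
    have hfm : Measurable f := Measurable.indicator (by fun_prop) (hmeas _)
    set e := MeasurableEquiv.piFinSuccAbove (fun _ : Fin (m + 1) => ℝ) 0 with he
    have hmp : MeasurePreserving e.symm volume volume :=
      (volume_preserving_piFinSuccAbove (fun _ : Fin (m + 1) => ℝ) 0).symm
    rw [← hmp.lintegral_comp hfm, Measure.volume_eq_prod,
      lintegral_prod (fun p => f (e.symm p)) (hfm.comp e.symm.measurable).aemeasurable]
    have hes : ∀ (t : ℝ) (y : Fin m → ℝ), e.symm (t, y) = Fin.cons t y := fun t y => by
      simp [he, MeasurableEquiv.piFinSuccAbove, Fin.insertNthEquiv]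
    have hγ' : 0 < ∑ i : Fin m, α i.succ + γ :=
      add_pos_of_nonneg_of_pos (Finset.sum_nonneg fun i _ => (hα _).le) hγ
    have hin : ∀ t ∈ Set.Ioo 0 s, ∫⁻ y : Fin m → ℝ, f (e.symm (t, y)) =
        ENNReal.ofReal ((∏ i : Fin m, Real.Gamma (α i.succ)) * Real.Gamma γ /
            Real.Gamma (∑ i : Fin m, α i.succ + γ)) *
          ENNReal.ofReal (t ^ (α 0 - 1) * (s - t) ^ (∑ i : Fin m, α i.succ + γ - 1)) := by
      intro t ht
      have h1 : ∀ y : Fin m → ℝ, f (e.symm (t, y)) = ENNReal.ofReal (t ^ (α 0 - 1)) *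
          {y : Fin m → ℝ | (∀ i, 0 ≤ y i) ∧ ∑ i, y i ≤ s - t}.indicator
          (fun y => ENNReal.ofReal ((∏ i, y i ^ (α i.succ - 1)) *
            (s - t - ∑ i, y i) ^ (γ - 1))) y := by
        intro y
        rw [hes, hf]
        have hiff : (Fin.cons t y : Fin (m + 1) → ℝ) ∈
            {y : Fin (m + 1) → ℝ | (∀ i, 0 ≤ y i) ∧ ∑ i, y i ≤ s} ↔
            y ∈ {y : Fin m → ℝ | (∀ i, 0 ≤ y i) ∧ ∑ i, y i ≤ s - t} := by
          simp only [Set.mem_ofPred_eq, Fin.forall_fin_succ, Fin.cons_zero, Fin.cons_succ,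
            Fin.sum_univ_succ, le_sub_iff_add_le, ht.1.le, true_and]
          rw [add_comm t]
        by_cases hy : y ∈ {y : Fin m → ℝ | (∀ i, 0 ≤ y i) ∧ ∑ i, y i ≤ s - t}
        · rw [Set.indicator_of_mem (hiff.2 hy), Set.indicator_of_mem hy,
            ← ENNReal.ofReal_mul (Real.rpow_nonneg ht.1.le _)]
          congr 1
          simp only [Fin.prod_univ_succ, Fin.sum_univ_succ, Fin.cons_zero, Fin.cons_succ]
          rw [← mul_assoc, sub_sub]
        · rw [Set.indicator_of_notMem (fun h => hy (hiff.1 h)), Set.indicator_of_notMem hy,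
            mul_zero]
      simp_rw [h1]
      rw [lintegral_const_mul' _ _ ENNReal.ofReal_ne_top,
        ih (fun i => α i.succ) (fun i => hα _) (sub_pos.2 ht.2),
        ← ENNReal.ofReal_mul (Real.rpow_nonneg ht.1.le _), ← ENNReal.ofReal_mul (div_nonneg
          (mul_nonneg (Finset.prod_nonneg fun i _ => (Real.Gamma_pos_of_pos (hα _)).le)
            (Real.Gamma_pos_of_pos hγ).le) (Real.Gamma_pos_of_pos hγ').le)]
      congr 1
      ring
    have hout : ∀ t ∉ Set.Icc 0 s, ∫⁻ y : Fin m → ℝ, f (e.symm (t, y)) = 0 := by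
      intro t ht
      have h1 : ∀ y : Fin m → ℝ, f (e.symm (t, y)) = 0 := by
        intro y
        rw [hes, hf, Set.indicator_of_notMem]
        rintro ⟨h0, hsum⟩
        have h00 := h0 0
        rw [Fin.sum_univ_succ] at hsum
        simp only [Fin.cons_zero, Fin.cons_succ] at h00 hsum
        have : 0 ≤ ∑ i, y i := Finset.sum_nonneg fun i _ => by simpa using h0 i.succ
        exact ht ⟨h00, by linarith⟩
      simp [h1]
    have hae : ∀ᵐ t : ℝ, ∫⁻ y : Fin m → ℝ, f (e.symm (t, y)) = (Set.Ioo 0 s).indicator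
        (fun t => ENNReal.ofReal ((∏ i : Fin m, Real.Gamma (α i.succ)) * Real.Gamma γ /
            Real.Gamma (∑ i : Fin m, α i.succ + γ)) *
          ENNReal.ofReal (t ^ (α 0 - 1) * (s - t) ^ (∑ i : Fin m, α i.succ + γ - 1))) t := by
      have hn : ∀ a : ℝ, ∀ᵐ t : ℝ, t ≠ a := fun a => by simp [ae_iff]
      filter_upwards [hn 0, hn s] with t h0 hs'
      by_cases ht : t ∈ Set.Ioo 0 s
      · rw [Set.indicator_of_mem ht, hin t ht]
      · rw [Set.indicator_of_notMem ht, hout t]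
        intro h
        exact ht ⟨lt_of_le_of_ne h.1 (Ne.symm h0), lt_of_le_of_ne h.2 hs'⟩
    have hae' := lintegral_congr_ae hae
    change ∫⁻ t : ℝ, ∫⁻ y : Fin m → ℝ, f (e.symm (t, y)) = _
    rw [hae', lintegral_indicator measurableSet_Ioo, lintegral_const_mul' _ _ ENNReal.ofReal_ne_top,
      lintegral_beta_scaled (hα 0) hγ' hs,
      ← ENNReal.ofReal_mul (div_nonneg
          (mul_nonneg (Finset.prod_nonneg fun i _ => (Real.Gamma_pos_of_pos (hα _)).le)
            (Real.Gamma_pos_of_pos hγ).le) (Real.Gamma_pos_of_pos hγ').le)]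
    have hG := (Real.Gamma_pos_of_pos hγ').ne'
    simp only [Fin.prod_univ_succ, Fin.sum_univ_succ, add_assoc]
    congr 1
    field_simp

theorem lintegral_dirichletDensity {m : ℕ} {α : Fin (m + 1) → ℝ} (hα : ∀ i, 0 < α i) :
    ∫⁻ y, ENNReal.ofReal (dirichletDensity α (y : Fin m → ℝ)) ∂(lebesgue m) = 1 := by
  have hset : simplex m = {y : Fin m → ℝ | (∀ i, 0 ≤ y i) ∧ ∑ i, y i ≤ 1} := by
    ext y
    refine ⟨fun h => ⟨fun i => (h.1 i).1, h.2⟩, fun h => ⟨fun i => ⟨h.1 i, ?_⟩, h.2⟩⟩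
    exact (Finset.single_le_sum (fun j _ => h.1 j) (Finset.mem_univ i)).trans h.2
  rw [lebesgue, lintegral_subtype_comap (measurableSet_simplex m)
    (f := fun y : Fin m → ℝ => ENNReal.ofReal (dirichletDensity α y))]
  have hc : 0 < Real.Gamma (∑ i, α i) / ∏ i, Real.Gamma (α i) :=
    div_pos (Real.Gamma_pos_of_pos (Finset.sum_pos (fun i _ => hα i) Finset.univ_nonempty))
      (Finset.prod_pos fun i _ => Real.Gamma_pos_of_pos (hα i))
  have hk := lintegral_dirichlet_kernel m (fun i => α i.castSucc) (fun i => hα _)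
    (hα (Fin.last m)) one_pos
  rw [← hset, lintegral_indicator (measurableSet_simplex m)] at hk
  simp only [dirichletDensity, ENNReal.ofReal_mul hc.le]
  rw [lintegral_const_mul' _ _ ENNReal.ofReal_ne_top, hk, ← ENNReal.ofReal_mul hc.le,
    Real.one_rpow, mul_one, ← Fin.sum_univ_castSucc, ← Fin.prod_univ_castSucc
      (fun i => Real.Gamma (α i)), div_mul_div_cancel₀, div_self, ENNReal.ofReal_one]
  · exact (Real.Gamma_pos_of_pos (Finset.sum_pos (fun i _ => hα i) Finset.univ_nonempty)).ne'
  · exact (Finset.prod_pos fun i _ => Real.Gamma_pos_of_pos (hα i)).ne'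

/-! ### Bernstein form of the Dirichlet densities -/

/-- The barycentric coordinates `(y_1, …, y_m, 1 - ∑ y_i)`. -/
def barycentric {m : ℕ} (y : Fin m → ℝ) : Fin (m + 1) → ℝ :=
  Fin.snoc (α := fun _ => ℝ) y (1 - ∑ i, y i)

theorem barycentric_nonneg {m : ℕ} {y : Fin m → ℝ} (hy : y ∈ simplex m) (i : Fin (m + 1)) :
    0 ≤ barycentric y i := by
  refine Fin.lastCases ?_ (fun i => ?_) i
  · simpa [barycentric] using hy.2
  · simpa [barycentric] using (hy.1 i).1

theorem sum_barycentric {m : ℕ} (y : Fin m → ℝ) : ∑ i, barycentric y i = 1 := by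
  simp [Fin.sum_univ_castSucc, barycentric]

theorem barycentric_le_one {m : ℕ} {y : Fin m → ℝ} (hy : y ∈ simplex m) (i : Fin (m + 1)) :
    barycentric y i ≤ 1 := by
  rw [← sum_barycentric y]
  exact Finset.single_le_sum (fun j _ => barycentric_nonneg hy j) (Finset.mem_univ i)

/-- A Dirichlet density with positive integer parameters is a multiple of a Bernstein polynomial. -/
theorem dirichletDensity_natCast_add_one {m : ℕ} (a : Fin (m + 1) → ℕ) (y : Fin m → ℝ) :
    dirichletDensity (fun i => (a i : ℝ) + 1) y =
      ((∑ i, a i + m).factorial : ℝ) / (∏ i, ((a i).factorial : ℝ)) *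
        ∏ i, barycentric y i ^ a i := by
  have h1 : Real.Gamma (∑ i, ((a i : ℝ) + 1)) = ((∑ i, a i + m).factorial : ℝ) := by
    rw [← Real.Gamma_nat_eq_factorial]
    congr 1
    rw [Finset.sum_add_distrib]
    push_cast
    simp
    ring
  simp only [dirichletDensity, h1, Real.Gamma_nat_eq_factorial, add_sub_cancel_right,
    Real.rpow_natCast]
  rw [Fin.prod_univ_castSucc (fun i => barycentric y i ^ a i)]
  simp [barycentric]

theorem dirichletDensity_natCast_add_one_nonneg {m : ℕ} (a : Fin (m + 1) → ℕ) {y : Fin m → ℝ}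
    (hy : y ∈ simplex m) : 0 ≤ dirichletDensity (fun i => (a i : ℝ) + 1) y := by
  rw [dirichletDensity_natCast_add_one]
  exact mul_nonneg (div_nonneg (by positivity) (by positivity))
    (Finset.prod_nonneg fun i _ => pow_nonneg (barycentric_nonneg hy i) _)

theorem dirichletDensity_natCast_add_one_le {m : ℕ} (a : Fin (m + 1) → ℕ) {y : Fin m → ℝ}
    (hy : y ∈ simplex m) :
    dirichletDensity (fun i => (a i : ℝ) + 1) y ≤ ((∑ i, a i + m).factorial : ℝ) := by
  rw [dirichletDensity_natCast_add_one]
  have h1 : (1 : ℝ) ≤ ∏ i, ((a i).factorial : ℝ) :=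
    Finset.one_le_prod fun i _ => by exact_mod_cast Nat.succ_le_of_lt (Nat.factorial_pos _)
  have h2 : ∏ i, barycentric y i ^ a i ≤ 1 :=
    Finset.prod_le_one (fun i _ => pow_nonneg (barycentric_nonneg hy i) _)
      fun i _ => pow_le_one₀ (barycentric_nonneg hy i) (barycentric_le_one hy i)
  have h3 : ((∑ i, a i + m).factorial : ℝ) / (∏ i, ((a i).factorial : ℝ)) ≤
      ((∑ i, a i + m).factorial : ℝ) := div_le_self (by positivity) h1
  calc _ ≤ ((∑ i, a i + m).factorial : ℝ) * 1 :=
        mul_le_mul h3 h2 (Finset.prod_nonneg fun i _ => pow_nonneg (barycentric_nonneg hy i) _)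
          (by positivity)
    _ = _ := mul_one _

/-- The parameters `α(k, ⌈kθ⌉)` are positive integers with sum `k + m`. -/
theorem exists_dirichletParam_eq {m : ℕ} (hm : 1 ≤ m) {k : ℕ} (hk : 1 ≤ k) {θ : Fin m → ℝ}
    (hθ : θ ∈ simplexPos m) :
    ∃ a : Fin (m + 1) → ℕ, dirichletParam k θ = (fun i => (a i : ℝ) + 1) ∧ ∑ i, a i + 1 = k := by
  have hk0 : (0 : ℝ) < k := by exact_mod_cast hk
  have hpos : ∀ i, 1 ≤ ⌈(k : ℝ) * θ i⌉ := fun i => Int.ceil_pos.2 (mul_pos hk0 (hθ.2 i))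
  choose b hb using fun i => Int.eq_ofNat_of_zero_le (sub_nonneg.2 (hpos i))
  have hb' : ∀ i, (⌈(k : ℝ) * θ i⌉ : ℝ) = (b i : ℝ) + 1 := by
    intro i
    have : ⌈(k : ℝ) * θ i⌉ = (b i : ℤ) + 1 := by rw [← hb i]; ring
    rw [this]
    push_cast
    rfl
  have hlt : ∑ i, ((b i : ℝ)) < k := by
    have : Nonempty (Fin m) := ⟨⟨0, hm⟩⟩
    calc ∑ i, (b i : ℝ) < ∑ i, (k : ℝ) * θ i := by
          refine Finset.sum_lt_sum_of_nonempty Finset.univ_nonempty fun i _ => ?_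
          have := Int.ceil_lt_add_one ((k : ℝ) * θ i)
          rw [hb' i] at this
          linarith
      _ = k * ∑ i, θ i := by rw [Finset.mul_sum]
      _ ≤ k * 1 := mul_le_mul_of_nonneg_left hθ.1.2 hk0.le
      _ = k := mul_one _
  have hltN : ∑ i, b i < k := by exact_mod_cast hlt
  refine ⟨Fin.snoc (α := fun _ => ℕ) b (k - 1 - ∑ i, b i), ?_, ?_⟩
  · funext i
    refine Fin.lastCases ?_ (fun i => ?_) i
    · simp only [dirichletParam, Fin.snoc_last, hb', Finset.sum_add_distrib]
      have h1 : k - 1 - ∑ i, b i + (1 + ∑ i, b i) = k := by omega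
      have h2 : ((k - 1 - ∑ i, b i : ℕ) : ℝ) + (1 + ∑ i, (b i : ℝ)) = k := by exact_mod_cast h1
      simp
      linarith
    · simp [dirichletParam, hb']
  · rw [Fin.sum_univ_castSucc]
    simp only [Fin.snoc_castSucc, Fin.snoc_last]
    omega

theorem dirichletDensity_dirichletParam_nonneg {m : ℕ} (hm : 1 ≤ m) {k : ℕ} (hk : 1 ≤ k)
    {θ : Fin m → ℝ} (hθ : θ ∈ simplexPos m) {y : Fin m → ℝ} (hy : y ∈ simplex m) :
    0 ≤ dirichletDensity (dirichletParam k θ) y := by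
  obtain ⟨a, ha, -⟩ := exists_dirichletParam_eq hm hk hθ
  rw [ha]
  exact dirichletDensity_natCast_add_one_nonneg a hy

theorem dirichletDensity_dirichletParam_le {m : ℕ} (hm : 1 ≤ m) {k : ℕ} (hk : 1 ≤ k)
    {θ : Fin m → ℝ} (hθ : θ ∈ simplexPos m) {y : Fin m → ℝ} (hy : y ∈ simplex m) :
    dirichletDensity (dirichletParam k θ) y ≤ ((k + m).factorial : ℝ) := by
  obtain ⟨a, ha, hak⟩ := exists_dirichletParam_eq hm hk hθ
  rw [ha]
  refine (dirichletDensity_natCast_add_one_le a hy).trans ?_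
  exact_mod_cast Nat.factorial_le (by omega)

theorem lintegral_dirichletDensity_dirichletParam {m : ℕ} (hm : 1 ≤ m) {k : ℕ} (hk : 1 ≤ k)
    {θ : Fin m → ℝ} (hθ : θ ∈ simplexPos m) :
    ∫⁻ y, ENNReal.ofReal (dirichletDensity (dirichletParam k θ) (y : Fin m → ℝ)) ∂(lebesgue m) =
      1 := by
  obtain ⟨a, ha, -⟩ := exists_dirichletParam_eq hm hk hθ
  rw [ha]
  exact lintegral_dirichletDensity fun i => by positivity

theorem measurable_dirichletDensity {m : ℕ} (α : Fin (m + 1) → ℝ) :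
    Measurable (dirichletDensity (m := m) α) := by
  unfold dirichletDensity
  fun_prop

/-- The Dirichlet parameters take countably many values, so the joint measurability follows
without appealing to the measurability of the Gamma function. -/
theorem measurable_dirichletDensity_dirichletParam {A : Type*} [MeasurableSpace A] {m : ℕ}
    {k : A → ℕ} {θ y : A → Fin m → ℝ} (hk : Measurable k) (hθ : Measurable θ)
    (hy : Measurable y) :
    Measurable fun a => dirichletDensity (dirichletParam (k a) (θ a)) (y a) := by
  let g : (ℕ × (Fin m → ℤ)) × (Fin m → ℝ) → ℝ := fun b =>
    dirichletDensity (Fin.snoc (α := fun _ => ℝ) (fun i => (b.1.2 i : ℝ))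
      ((b.1.1 : ℝ) + m - ∑ i, (b.1.2 i : ℝ))) b.2
  have hg : Measurable g := by
    refine measurable_from_prod_countable_right fun c => ?_
    exact measurable_dirichletDensity (Fin.snoc (α := fun _ => ℝ) (fun i => (c.2 i : ℝ))
      ((c.1 : ℝ) + m - ∑ i, (c.2 i : ℝ)))
  have hceil : Measurable fun a => fun i => ⌈(k a : ℝ) * θ a i⌉ := by
    refine measurable_pi_lambda _ fun i => Measurable.ceil ?_
    have h1 : Measurable fun a => (k a : ℝ) := measurable_from_nat.comp hk
    have h2 : Measurable fun a => θ a i := (measurable_pi_apply i).comp hθ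
    exact h1.mul h2
  have heq : (fun a => dirichletDensity (dirichletParam (k a) (θ a)) (y a)) =
      g ∘ fun a => ((k a, fun i => ⌈(k a : ℝ) * θ a i⌉), y a) := by
    funext a
    simp only [g, Function.comp, dirichletParam]
  rw [heq]
  exact hg.comp ((hk.prodMk hceil).prodMk hy)

/-! ### Stick-breaking mixtures -/

theorem stickWeight_nonneg {V : ℕ → ℝ} (hV : ∀ j, V j ∈ Set.Icc (0 : ℝ) 1) (j : ℕ) :
    0 ≤ stickWeight V j :=
  mul_nonneg (hV j).1 (Finset.prod_nonneg fun l _ => sub_nonneg.2 (hV l).2)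

theorem sum_range_stickWeight (V : ℕ → ℝ) (n : ℕ) :
    ∑ j ∈ Finset.range n, stickWeight V j = 1 - ∏ l ∈ Finset.range n, (1 - V l) := by
  induction n with
  | zero => simp
  | succ n ih =>
    rw [Finset.sum_range_succ, ih, Finset.prod_range_succ, stickWeight]
    ring

theorem summable_stickWeight {V : ℕ → ℝ} (hV : ∀ j, V j ∈ Set.Icc (0 : ℝ) 1) :
    Summable (stickWeight V) := by
  refine summable_of_sum_range_le (stickWeight_nonneg hV) (c := 1) fun n => ?_
  rw [sum_range_stickWeight]
  exact sub_le_self _ (Finset.prod_nonneg fun l _ => sub_nonneg.2 (hV l).2)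

section Mixture

variable {m k : ℕ} {V : ℕ → ℝ} {θ : ℕ → Fin m → ℝ}

theorem mixture_term_nonneg (hm : 1 ≤ m) (hk : 1 ≤ k) (hV : ∀ j, V j ∈ Set.Icc (0 : ℝ) 1)
    (hθ : ∀ j, θ j ∈ simplexPos m) (y : simplex m) (j : ℕ) :
    0 ≤ stickWeight V j * dirichletDensity (dirichletParam k (θ j)) (y : Fin m → ℝ) :=
  mul_nonneg (stickWeight_nonneg hV j) (dirichletDensity_dirichletParam_nonneg hm hk (hθ j) y.2)

theorem summable_mixture (hm : 1 ≤ m) (hk : 1 ≤ k) (hV : ∀ j, V j ∈ Set.Icc (0 : ℝ) 1)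
    (hθ : ∀ j, θ j ∈ simplexPos m) (y : simplex m) :
    Summable fun j => stickWeight V j *
      dirichletDensity (dirichletParam k (θ j)) (y : Fin m → ℝ) :=
  Summable.of_nonneg_of_le (mixture_term_nonneg hm hk hV hθ y)
    (fun j => mul_le_mul_of_nonneg_left (dirichletDensity_dirichletParam_le hm hk (hθ j) y.2)
      (stickWeight_nonneg hV j)) ((summable_stickWeight hV).mul_right _)

theorem ofReal_mixtureDensity (hm : 1 ≤ m) (hk : 1 ≤ k) (hV : ∀ j, V j ∈ Set.Icc (0 : ℝ) 1)
    (hθ : ∀ j, θ j ∈ simplexPos m) (y : simplex m) :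
    ENNReal.ofReal (mixtureDensity k V θ y) = ∑' j, ENNReal.ofReal (stickWeight V j) *
      ENNReal.ofReal (dirichletDensity (dirichletParam k (θ j)) (y : Fin m → ℝ)) := by
  rw [mixtureDensity, ENNReal.ofReal_tsum_of_nonneg (mixture_term_nonneg hm hk hV hθ y)
    (summable_mixture hm hk hV hθ y)]
  exact tsum_congr fun j => ENNReal.ofReal_mul (stickWeight_nonneg hV j)

theorem sum_range_le_mixtureDensity (hm : 1 ≤ m) (hk : 1 ≤ k)
    (hV : ∀ j, V j ∈ Set.Icc (0 : ℝ) 1) (hθ : ∀ j, θ j ∈ simplexPos m) (y : simplex m) (n : ℕ) :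
    ∑ j ∈ Finset.range n, stickWeight V j *
      dirichletDensity (dirichletParam k (θ j)) (y : Fin m → ℝ) ≤ mixtureDensity k V θ y :=
  (summable_mixture hm hk hV hθ y).sum_le_tsum _ fun j _ => mixture_term_nonneg hm hk hV hθ y j

theorem lintegral_mixtureDensity (hm : 1 ≤ m) (hk : 1 ≤ k) (hV : ∀ j, V j ∈ Set.Icc (0 : ℝ) 1)
    (hθ : ∀ j, θ j ∈ simplexPos m) :
    ∫⁻ y, ENNReal.ofReal (mixtureDensity k V θ y) ∂(lebesgue m) =
      ∑' j, ENNReal.ofReal (stickWeight V j) := by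
  simp_rw [ofReal_mixtureDensity hm hk hV hθ]
  have hmeas : ∀ j, Measurable fun y : simplex m => ENNReal.ofReal (stickWeight V j) *
      ENNReal.ofReal (dirichletDensity (dirichletParam k (θ j)) (y : Fin m → ℝ)) := fun j =>
    ((measurable_dirichletDensity _).comp measurable_subtype_coe).ennreal_ofReal.const_mul _
  rw [lintegral_tsum fun j => (hmeas j).aemeasurable]
  refine tsum_congr fun j => ?_
  rw [lintegral_const_mul' _ _ ENNReal.ofReal_ne_top,
    lintegral_dirichletDensity_dirichletParam hm hk (hθ j), mul_one]

end Mixture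

theorem tsum_ofReal_stickWeight_eq_one {V : ℕ → ℝ} (hV : ∀ j, V j ∈ Set.Icc (0 : ℝ) 1)
    (h0 : ⨅ n : ℕ, ∏ l ∈ Finset.range n, ENNReal.ofReal (1 - V l) = 0) :
    ∑' j, ENNReal.ofReal (stickWeight V j) = 1 := by
  have hpart : ∀ n, ∑ j ∈ Finset.range n, ENNReal.ofReal (stickWeight V j) +
      ∏ l ∈ Finset.range n, ENNReal.ofReal (1 - V l) = 1 := by
    intro n
    have hp : 0 ≤ ∏ l ∈ Finset.range n, (1 - V l) :=
      Finset.prod_nonneg fun l _ => sub_nonneg.2 (hV l).2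
    rw [← ENNReal.ofReal_sum_of_nonneg fun j _ => stickWeight_nonneg hV j,
      ← ENNReal.ofReal_prod_of_nonneg fun l _ => sub_nonneg.2 (hV l).2,
      ← ENNReal.ofReal_add (Finset.sum_nonneg fun j _ => stickWeight_nonneg hV j) hp,
      sum_range_stickWeight]
    simp
  refine le_antisymm ?_ ?_
  · rw [ENNReal.tsum_eq_iSup_nat]
    exact iSup_le fun n => le_self_add.trans (hpart n).le
  · have : ∀ n, 1 ≤ ∑' j, ENNReal.ofReal (stickWeight V j) +
        ∏ l ∈ Finset.range n, ENNReal.ofReal (1 - V l) := fun n => by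
      rw [← hpart n]
      exact add_le_add_left (ENNReal.sum_le_tsum _) _
    calc (1 : ℝ≥0∞) ≤ ⨅ n, (∑' j, ENNReal.ofReal (stickWeight V j) +
          ∏ l ∈ Finset.range n, ENNReal.ofReal (1 - V l)) := le_iInf this
      _ = ∑' j, ENNReal.ofReal (stickWeight V j) := by
        rw [← ENNReal.add_iInf, h0, add_zero]

/-! ### The common structure of the three models -/

section Ingredients

variable {Ω : Type*} [MeasurableSpace Ω] {m p : ℕ} {X : Set (Fin p → ℝ)}

/-- What the three models have in common: stick-breaking variables `V_j(x) ∈ [0,1]` and atoms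
`θ_j(x) ∈ Δ_m^0`, either of which may be constant in `x`, both seen as random functions of `x`. -/
structure IsRandomMixture (P : Measure Ω) (k : Ω → ℕ) (V : ℕ → X → Ω → ℝ)
    (θ : ℕ → X → Ω → Fin m → ℝ) : Prop where
  degree : IsDegree k
  measurable_weight : ∀ j, Measurable fun a : X × Ω => V j a.1 a.2
  weight_mem : ∀ j x ω, V j x ω ∈ Set.Icc (0 : ℝ) 1
  iIndepFun_weight : iIndepFun (fun j ω x => V j x ω) P
  identDistrib_weight : ∀ i j x, IdentDistrib (V i x) (V j x) P P
  weight_pos : ∀ x, P {ω | 0 < V 0 x ω} ≠ 0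
  measurable_atom : ∀ j, Measurable fun a : X × Ω => θ j a.1 a.2
  atom_mem : ∀ j x ω, θ j x ω ∈ simplexPos m
  iIndepFun_atom : iIndepFun (fun j ω x => θ j x ω) P
  indep_weight : IndepFun (fun ω j x => V j x ω) (fun ω => (fun j x => θ j x ω, k ω)) P
  indep_atom : IndepFun (fun ω j x => θ j x ω) k P

variable {P : Measure Ω} {k : Ω → ℕ} {V : ℕ → X → Ω → ℝ} {θ : ℕ → X → Ω → Fin m → ℝ}

theorem IsRandomMixture.measurable_stickWeight (hM : IsRandomMixture P k V θ) (j : ℕ) :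
    Measurable fun a : X × Ω => stickWeight (fun j => V j a.1 a.2) j := by
  unfold stickWeight
  exact (hM.measurable_weight j).mul
    (Finset.measurable_fun_prod _ fun l _ => (hM.measurable_weight l).const_sub 1)

/-- The random density is jointly measurable. -/
theorem IsRandomMixture.measurable_mixtureDensity (hm : 1 ≤ m) (hM : IsRandomMixture P k V θ) :
    Measurable fun a : Ω × (simplex m × X) => ENNReal.ofReal
      (mixtureDensity (k a.1) (fun j => V j a.2.2 a.1) (fun j => θ j a.2.2 a.1) a.2.1) := by
  have h1 : (fun a : Ω × (simplex m × X) => ENNReal.ofReal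
      (mixtureDensity (k a.1) (fun j => V j a.2.2 a.1) (fun j => θ j a.2.2 a.1) a.2.1)) =
      fun a => ∑' j, ENNReal.ofReal (stickWeight (fun j => V j a.2.2 a.1) j) *
        ENNReal.ofReal (dirichletDensity (dirichletParam (k a.1) (θ j a.2.2 a.1))
          (a.2.1 : Fin m → ℝ)) := by
    funext a
    exact ofReal_mixtureDensity hm (hM.degree.one_le a.1) (fun j => hM.weight_mem j _ _)
      (fun j => hM.atom_mem j _ _) a.2.1
  rw [h1]
  have hxω : Measurable fun a : Ω × (simplex m × X) => (a.2.2, a.1) := by fun_prop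
  refine Measurable.tsum fun j => ?_
  refine (((hM.measurable_stickWeight j).comp hxω).ennreal_ofReal).mul ?_
  refine Measurable.ennreal_ofReal (measurable_dirichletDensity_dirichletParam
    (hM.degree.measurable.comp measurable_fst) ((hM.measurable_atom j).comp hxω)
    (measurable_subtype_coe.comp (measurable_fst.comp measurable_snd)))

/-- At each predictor value the weights add up to one almost surely, because the expected
length of the remaining stick decays geometrically. -/
theorem IsRandomMixture.ae_tsum_stickWeight [IsProbabilityMeasure P]
    (hM : IsRandomMixture P k V θ) (x : X) :
    ∀ᵐ ω ∂P, ∑' j, ENNReal.ofReal (stickWeight (fun j => V j x ω) j) = 1 := by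
  have hVm : ∀ j, Measurable (V j x) := fun j =>
    (hM.measurable_weight j).comp measurable_prodMk_left
  have hind : iIndepFun (fun j ω => ENNReal.ofReal (1 - V j x ω)) P :=
    hM.iIndepFun_weight.comp (g := fun _ (f : X → ℝ) => ENNReal.ofReal (1 - f x))
      fun _ => ((measurable_pi_apply x).const_sub 1).ennreal_ofReal
  have hgm : Measurable fun t : ℝ => ENNReal.ofReal (1 - t) := by fun_prop
  set r : ℝ≥0∞ := ∫⁻ ω, ENNReal.ofReal (1 - V 0 x ω) ∂P with hr
  have hint : ∀ n, ∫⁻ ω, ∏ l ∈ Finset.range n, ENNReal.ofReal (1 - V l x ω) ∂P = r ^ n := by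
    intro n
    rw [lintegral_prod_eq_prod_lintegral_of_indepFun _ _ hind fun j => hgm.comp (hVm j)]
    have : ∀ j, ∫⁻ ω, ENNReal.ofReal (1 - V j x ω) ∂P = r := fun j =>
      ((hM.identDistrib_weight j 0 x).comp hgm).lintegral_eq
    simp [this]
  have hr1 : r < 1 := by
    have hsum : r + ∫⁻ ω, ENNReal.ofReal (V 0 x ω) ∂P = 1 := by
      rw [hr, ← lintegral_add_left (f := fun ω => ENNReal.ofReal (1 - V 0 x ω))
        (hgm.comp (hVm 0))]
      have : ∀ ω, ENNReal.ofReal (1 - V 0 x ω) + ENNReal.ofReal (V 0 x ω) = 1 := fun ω => by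
        rw [← ENNReal.ofReal_add (sub_nonneg.2 (hM.weight_mem 0 x ω).2) (hM.weight_mem 0 x ω).1]
        simp
      simp [this]
    have hpos : ∫⁻ ω, ENNReal.ofReal (V 0 x ω) ∂P ≠ 0 := by
      rw [Ne, lintegral_eq_zero_iff (hVm 0).ennreal_ofReal]
      intro h0
      refine hM.weight_pos x (measure_mono_null ?_ (ae_iff.1 h0))
      intro ω (hω : 0 < V 0 x ω) h1
      exact (ENNReal.ofReal_pos.2 hω).ne' h1
    have hrT : r ≠ ∞ := ne_top_of_le_ne_top ENNReal.one_ne_top (hsum ▸ le_self_add)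
    rw [← hsum]
    exact ENNReal.lt_add_right hrT hpos
  have hinf : ∫⁻ ω, ⨅ n : ℕ, ∏ l ∈ Finset.range n, ENNReal.ofReal (1 - V l x ω) ∂P = 0 := by
    refine le_antisymm (ge_of_tendsto' (ENNReal.tendsto_pow_atTop_nhds_zero_of_lt_one hr1)
      fun n => ?_) zero_le
    rw [← hint n]
    exact lintegral_mono fun ω => iInf_le _ n
  have hmeas : Measurable fun ω => ⨅ n : ℕ, ∏ l ∈ Finset.range n, ENNReal.ofReal (1 - V l x ω) :=
    Measurable.iInf fun n => Finset.measurable_fun_prod _ fun l _ => hgm.comp (hVm l)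
  filter_upwards [(lintegral_eq_zero_iff hmeas).1 hinf] with ω hω
  exact tsum_ofReal_stickWeight_eq_one (fun j => hM.weight_mem j x ω) hω

theorem IsRandomMixture.ae_lintegral_jointDensity [IsProbabilityMeasure P] (hm : 1 ≤ m)
    (hM : IsRandomMixture P k V θ) {ν : Measure X} [SigmaFinite ν] {q : X → ℝ}
    (hq : IsPredictorDensity ν q) :
    ∀ᵐ ω ∂P, ∫⁻ e, ENNReal.ofReal (jointDensity q
      (fun x y => mixtureDensity (k ω) (fun j => V j x ω) (fun j => θ j x ω) y) e)
        ∂((lebesgue m).prod ν) = 1 := by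
  have hset : MeasurableSet {a : X × Ω |
      ∑' j, ENNReal.ofReal (stickWeight (fun j => V j a.1 a.2) j) = 1} := by
    have : Measurable fun a : X × Ω =>
        ∑' j, ENNReal.ofReal (stickWeight (fun j => V j a.1 a.2) j) :=
      Measurable.tsum fun j => (hM.measurable_stickWeight j).ennreal_ofReal
    exact this (measurableSet_singleton 1)
  have hae := (Measure.ae_ae_comm (μ := ν) (ν := P)
    (p := fun x ω => ∑' j, ENNReal.ofReal (stickWeight (fun j => V j x ω) j) = 1) hset).1
    (ae_of_all _ hM.ae_tsum_stickWeight)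
  filter_upwards [hae] with ω hω
  have hfm := (hM.measurable_mixtureDensity hm).comp
    (measurable_prodMk_left (x := ω) (β := simplex m × X))
  simp only [jointDensity, ENNReal.ofReal_mul (hq.nonneg _)]
  have hfm' : Measurable fun e : simplex m × X => ENNReal.ofReal (q e.2) * ENNReal.ofReal
      (mixtureDensity (k ω) (fun j => V j e.2 ω) (fun j => θ j e.2 ω) e.1) :=
    ((hq.measurable.comp measurable_snd).ennreal_ofReal).mul hfm
  rw [lintegral_prod_symm _ hfm'.aemeasurable, ← hq.lintegral_eq_one]
  refine lintegral_congr_ae ?_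
  filter_upwards [hω] with x hx
  rw [lintegral_const_mul' _ _ ENNReal.ofReal_ne_top, lintegral_mixtureDensity hm
    (hM.degree.one_le ω) (fun j => hM.weight_mem j x ω) (fun j => hM.atom_mem j x ω), hx, mul_one]

end Ingredients

/-! ### Bernstein polynomials on the simplex -/

section Words

variable {α : Type*} [Fintype α]

theorem sum_word_succ {n : ℕ} (F : (Fin (n + 1) → α) → ℝ) :
    ∑ w, F w = ∑ a, ∑ w : Fin n → α, F (Fin.cons a w) := by
  rw [← (Fin.consEquiv fun _ : Fin (n + 1) => α).sum_comp, Fintype.sum_prod_type]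
  rfl

theorem sum_word_prod {p : α → ℝ} (hp : ∑ a, p a = 1) (n : ℕ) :
    ∑ w : Fin n → α, ∏ t, p (w t) = 1 := by
  induction n with
  | zero => simp
  | succ n ih =>
    rw [sum_word_succ]
    simp [Fin.prod_univ_succ, ← Finset.mul_sum, ih, hp]

theorem sum_word_prod_mul_sum {p f : α → ℝ} (hp : ∑ a, p a = 1) (hf : ∑ a, p a * f a = 0) (n : ℕ) :
    ∑ w : Fin n → α, (∏ t, p (w t)) * ∑ t, f (w t) = 0 := by
  induction n with
  | zero => simp
  | succ n ih =>
    rw [sum_word_succ]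
    have h : ∀ (a : α) (w : Fin n → α),
        (∏ t, p ((Fin.cons a w : Fin (n + 1) → α) t)) *
          ∑ t, f ((Fin.cons a w : Fin (n + 1) → α) t) =
        p a * f a * ∏ t, p (w t) + p a * ((∏ t, p (w t)) * ∑ t, f (w t)) := fun a w => by
      simp only [Fin.prod_univ_succ, Fin.sum_univ_succ, Fin.cons_zero, Fin.cons_succ]
      ring
    simp_rw [h, Finset.sum_add_distrib, ← Finset.mul_sum, ih, sum_word_prod hp, mul_one, hf]
    simp

/-- The variance of a sum of `n` independent centered variables. -/
theorem sum_word_prod_mul_sum_sq {p f : α → ℝ} (hp : ∑ a, p a = 1) (hf : ∑ a, p a * f a = 0)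
    (n : ℕ) :
    ∑ w : Fin n → α, (∏ t, p (w t)) * (∑ t, f (w t)) ^ 2 = n * ∑ a, p a * f a ^ 2 := by
  induction n with
  | zero => simp
  | succ n ih =>
    rw [sum_word_succ]
    have h : ∀ (a : α) (w : Fin n → α),
        (∏ t, p ((Fin.cons a w : Fin (n + 1) → α) t)) *
          (∑ t, f ((Fin.cons a w : Fin (n + 1) → α) t)) ^ 2 =
        p a * f a ^ 2 * ∏ t, p (w t) + 2 * (p a * f a) * ((∏ t, p (w t)) * ∑ t, f (w t)) +
          p a * ((∏ t, p (w t)) * (∑ t, f (w t)) ^ 2) := fun a w => by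
      simp only [Fin.prod_univ_succ, Fin.sum_univ_succ, Fin.cons_zero, Fin.cons_succ]
      ring
    simp_rw [h, Finset.sum_add_distrib, ← Finset.mul_sum, ih, sum_word_prod hp,
      sum_word_prod_mul_sum hp hf, mul_one, mul_zero, Finset.sum_const_zero, add_zero,
      ← Finset.sum_mul, hp]
    push_cast
    ring

/-- The number of occurrences of the letter `a` in the word `w`. -/
def letterCount [DecidableEq α] {n : ℕ} (w : Fin n → α) (a : α) : ℕ :=
  (Finset.univ.filter fun t => w t = a).card

theorem sum_letterCount [DecidableEq α] {n : ℕ} (w : Fin n → α) : ∑ a, letterCount w a = n := by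
  have := Finset.card_eq_sum_card_fiberwise (f := w) (s := Finset.univ) (t := Finset.univ)
    fun t _ => Finset.mem_univ _
  simpa [letterCount] using this.symm

theorem prod_pow_letterCount [DecidableEq α] {n : ℕ} (w : Fin n → α) (p : α → ℝ) :
    ∏ t, p (w t) = ∏ a, p a ^ letterCount w a := by
  rw [← Finset.prod_fiberwise (s := Finset.univ) (g := w) (f := fun t => p (w t))]
  refine Finset.prod_congr rfl fun a _ => ?_
  rw [Finset.prod_congr rfl (g := fun _ => p a) fun t ht => by rw [(Finset.mem_filter.1 ht).2],
    Finset.prod_const]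
  rfl

theorem letterCount_cast_sub {β : Type*} [DecidableEq β] {n : ℕ} (w : Fin n → β) (a : β) (s : ℝ) :
    (letterCount w a : ℝ) - n * s = ∑ t, ((if w t = a then (1 : ℝ) else 0) - s) := by
  simp [letterCount, Finset.sum_sub_distrib]

end Words

section Bernstein

variable {m n : ℕ}

/-- The vector of relative frequencies of the first `m` letters in a word of length `n`: the node
of the simplex attached to the word. -/
def wordNode (w : Fin n → Fin (m + 1)) : Fin m → ℝ :=
  fun i => (letterCount w i.castSucc : ℝ) / n

theorem sum_letterCount_castSucc_le (w : Fin n → Fin (m + 1)) :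
    ∑ i : Fin m, letterCount w i.castSucc ≤ n := by
  have := sum_letterCount w
  rw [Fin.sum_univ_castSucc] at this
  omega

theorem wordNode_mem (w : Fin n → Fin (m + 1)) : wordNode w ∈ simplex m := by
  have hsum : ∑ i, wordNode w i ≤ 1 := by
    simp only [wordNode]
    rw [← Finset.sum_div]
    refine div_le_one_of_le₀ ?_ (Nat.cast_nonneg _)
    exact_mod_cast sum_letterCount_castSucc_le w
  have hnn : ∀ i, 0 ≤ wordNode w i := fun i => div_nonneg (Nat.cast_nonneg _) (Nat.cast_nonneg _)
  exact ⟨fun i => ⟨hnn i, (Finset.single_le_sum (fun j _ => hnn j) (Finset.mem_univ i)).trans hsum⟩,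
    hsum⟩

theorem sum_word_sq_sub_le (hn : 1 ≤ n) {y : Fin m → ℝ} (hy : y ∈ simplex m) (i : Fin m) :
    ∑ w : Fin n → Fin (m + 1), (∏ t, barycentric y (w t)) * (wordNode w i - y i) ^ 2 ≤
      1 / (n : ℝ) := by
  have hn0 : (0 : ℝ) < n := by exact_mod_cast hn
  set f : Fin (m + 1) → ℝ := fun a => (if a = i.castSucc then (1 : ℝ) else 0) - y i with hf
  have hb : barycentric y i.castSucc = y i := by simp [barycentric]
  have hmean : ∑ a, barycentric y a * f a = 0 := by
    simp [hf, mul_sub, Finset.sum_sub_distrib, ← Finset.sum_mul, sum_barycentric, hb]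
  have hw : ∀ w : Fin n → Fin (m + 1), (∏ t, barycentric y (w t)) * (wordNode w i - y i) ^ 2 =
      1 / (n : ℝ) ^ 2 * ((∏ t, barycentric y (w t)) * (∑ t, f (w t)) ^ 2) := by
    intro w
    simp only [hf]
    rw [← letterCount_cast_sub, wordNode]
    field_simp
  simp_rw [hw]
  rw [← Finset.mul_sum, sum_word_prod_mul_sum_sq (sum_barycentric y) hmean]
  have hvar : ∑ a, barycentric y a * f a ^ 2 ≤ 1 := by
    rw [← sum_barycentric y]
    refine Finset.sum_le_sum fun a _ => mul_le_of_le_one_right (barycentric_nonneg hy a) ?_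
    have h0 := (hy.1 i).1
    have h1 := (hy.1 i).2
    simp only [hf]
    split_ifs <;> nlinarith
  calc 1 / (n : ℝ) ^ 2 * ((n : ℝ) * ∑ a, barycentric y a * f a ^ 2)
      ≤ 1 / (n : ℝ) ^ 2 * ((n : ℝ) * 1) := by gcongr
    _ = 1 / (n : ℝ) := by field_simp

/-- Quantitative convergence of Bernstein polynomials on the simplex. -/
theorem abs_bernstein_sub_le (hn : 1 ≤ n) {G : simplex m → ℝ} {δ K : ℝ} (hK : 0 ≤ K)
    (hG : ∀ z y : simplex m, |G z - G y| ≤ δ + K * ∑ i, ((z : Fin m → ℝ) i - (y : Fin m → ℝ) i) ^ 2)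
    (y : simplex m) :
    |∑ w : Fin n → Fin (m + 1), (∏ t, barycentric (y : Fin m → ℝ) (w t)) *
        G ⟨wordNode w, wordNode_mem w⟩ - G y| ≤ δ + K * (m / n) := by
  have hb : ∀ w : Fin n → Fin (m + 1), 0 ≤ ∏ t, barycentric (y : Fin m → ℝ) (w t) := fun w =>
    Finset.prod_nonneg fun t _ => barycentric_nonneg y.2 _
  have h1 := sum_word_prod (sum_barycentric (y : Fin m → ℝ)) n
  calc _ = |∑ w : Fin n → Fin (m + 1), (∏ t, barycentric (y : Fin m → ℝ) (w t)) *
        (G ⟨wordNode w, wordNode_mem w⟩ - G y)| := by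
        simp_rw [mul_sub, Finset.sum_sub_distrib, ← Finset.sum_mul, h1, one_mul]
    _ ≤ ∑ w : Fin n → Fin (m + 1), (∏ t, barycentric (y : Fin m → ℝ) (w t)) *
        (δ + K * ∑ i, (wordNode w i - (y : Fin m → ℝ) i) ^ 2) := by
        refine (Finset.abs_sum_le_sum_abs _ _).trans (Finset.sum_le_sum fun w _ => ?_)
        rw [abs_mul, abs_of_nonneg (hb w)]
        exact mul_le_mul_of_nonneg_left (hG _ _) (hb w)
    _ = δ + K * ∑ i, ∑ w : Fin n → Fin (m + 1), (∏ t, barycentric (y : Fin m → ℝ) (w t)) *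
        (wordNode w i - (y : Fin m → ℝ) i) ^ 2 := by
        simp_rw [mul_add, Finset.sum_add_distrib, ← Finset.sum_mul, h1, one_mul]
        rw [Finset.sum_comm, Finset.mul_sum]
        congr 1
        refine Finset.sum_congr rfl fun w _ => ?_
        rw [← Finset.mul_sum]
        ring
    _ ≤ δ + K * ∑ _i : Fin m, 1 / (n : ℝ) := by
        gcongr with i
        exact sum_word_sq_sub_le hn y.2 i
    _ = δ + K * (m / n) := by
        simp [div_eq_mul_inv]

/-- The constant relating a monomial of degree `n` to the corresponding Dirichlet density. -/
def wordConst (w : Fin n → Fin (m + 1)) : ℝ :=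
  (∏ a, ((letterCount w a).factorial : ℝ)) / ((n + m).factorial : ℝ)

theorem wordConst_pos (w : Fin n → Fin (m + 1)) : 0 < wordConst w :=
  div_pos (Finset.prod_pos fun a _ => by exact_mod_cast Nat.factorial_pos _)
    (by exact_mod_cast Nat.factorial_pos _)

theorem prod_barycentric_eq (w : Fin n → Fin (m + 1)) (y : Fin m → ℝ) :
    ∏ t, barycentric y (w t) =
      wordConst w * dirichletDensity (fun a => (letterCount w a : ℝ) + 1) y := by
  rw [dirichletDensity_natCast_add_one, prod_pow_letterCount, sum_letterCount, wordConst]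
  have h1 : (∏ a, ((letterCount w a).factorial : ℝ)) ≠ 0 :=
    (Finset.prod_pos fun a _ => by exact_mod_cast Nat.factorial_pos _).ne'
  have h2 : ((n + m).factorial : ℝ) ≠ 0 := by exact_mod_cast Nat.factorial_ne_zero _
  field_simp

/-- A point well inside the cell of atoms whose Dirichlet parameters are those of the word. -/
def cellPoint (w : Fin n → Fin (m + 1)) : Fin m → ℝ :=
  fun i => ((letterCount w i.castSucc : ℝ) + 1 / (m + 1)) / (n + 1)

theorem cellPoint_mem (w : Fin n → Fin (m + 1)) : cellPoint w ∈ simplexPos m := by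
  have hpos : ∀ i, 0 < cellPoint w i := fun i => by
    unfold cellPoint
    positivity
  have hsum : ∑ i, cellPoint w i ≤ 1 := by
    simp only [cellPoint]
    rw [← Finset.sum_div, Finset.sum_add_distrib]
    refine div_le_one_of_le₀ ?_ (by positivity)
    have h1 : (∑ i : Fin m, (letterCount w i.castSucc : ℝ)) ≤ n := by
      exact_mod_cast sum_letterCount_castSucc_le w
    have h2 : ∑ _i : Fin m, 1 / ((m : ℝ) + 1) ≤ 1 := by
      simp only [Finset.sum_const, Finset.card_univ, Fintype.card_fin, nsmul_eq_mul]
      rw [mul_one_div]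
      exact div_le_one_of_le₀ (by linarith) (by positivity)
    linarith
  exact ⟨⟨fun i => ⟨(hpos i).le,
    (Finset.single_le_sum (fun j _ => (hpos j).le) (Finset.mem_univ i)).trans hsum⟩, hsum⟩, hpos⟩

theorem dirichletParam_eq_of_near (hm : 1 ≤ m) (w : Fin n → Fin (m + 1)) {θ : Fin m → ℝ}
    (hθ : ‖θ - cellPoint w‖ < 1 / (((m : ℝ) + 1) * (n + 1))) :
    dirichletParam (n + 1) θ = fun a => (letterCount w a : ℝ) + 1 := by
  have hm' : (1 : ℝ) ≤ m := by exact_mod_cast hm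
  have hceil : ∀ i, ⌈((n + 1 : ℕ) : ℝ) * θ i⌉ = (letterCount w i.castSucc : ℤ) + 1 := by
    intro i
    have h1 : |θ i - cellPoint w i| < 1 / (((m : ℝ) + 1) * (n + 1)) :=
      lt_of_le_of_lt (norm_le_pi_norm (θ - cellPoint w) i) hθ
    have h2 : ((n : ℝ) + 1) * cellPoint w i = (letterCount w i.castSucc : ℝ) + 1 / (m + 1) := by
      simp only [cellPoint]
      field_simp
    have h3 : |((n : ℝ) + 1) * θ i - ((letterCount w i.castSucc : ℝ) + 1 / (m + 1))| <
        1 / (m + 1) := by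
      rw [← h2, ← mul_sub, abs_mul, abs_of_pos (by positivity : (0 : ℝ) < n + 1)]
      calc _ < ((n : ℝ) + 1) * (1 / (((m : ℝ) + 1) * (n + 1))) := by gcongr
        _ = _ := by field_simp
    have h4 : 1 / ((m : ℝ) + 1) ≤ 1 / 2 := by gcongr; linarith
    rw [abs_lt] at h3
    rw [Int.ceil_eq_iff]
    push_cast
    constructor <;> linarith
  have hcast : ∀ i, (⌈((n + 1 : ℕ) : ℝ) * θ i⌉ : ℝ) = (letterCount w i.castSucc : ℝ) + 1 := by
    intro i
    rw [hceil i]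
    push_cast
    rfl
  funext a
  refine Fin.lastCases ?_ (fun i => ?_) a
  · simp only [dirichletParam, Fin.snoc_last, hcast, Finset.sum_add_distrib]
    have h := sum_letterCount w
    rw [Fin.sum_univ_castSucc] at h
    have h' : (∑ i : Fin m, (letterCount w i.castSucc : ℝ)) + letterCount w (Fin.last m) = n := by
      exact_mod_cast h
    simp
    linarith
  · simp only [dirichletParam, Fin.snoc_castSucc, hcast]

end Bernstein

theorem isCompact_simplex (m : ℕ) : IsCompact (simplex m) := by
  have h1 : IsClosed {y : Fin m → ℝ | ∀ i, y i ∈ Set.Icc (0 : ℝ) 1} := by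
    simp only [Set.ofPred_forall]
    exact isClosed_iInter fun i => isClosed_Icc.preimage (continuous_apply i)
  have h2 : IsClosed {y : Fin m → ℝ | ∑ i, y i ≤ 1} :=
    isClosed_le (by fun_prop) continuous_const
  refine (isCompact_Icc (a := (0 : Fin m → ℝ)) (b := 1)).of_isClosed_subset (h1.inter h2) ?_
  exact fun y hy => ⟨fun i => (hy.1 i).1, fun i => (hy.1 i).2⟩

theorem lebesgue_univ_le_one (m : ℕ) : lebesgue m Set.univ ≤ 1 := by
  rw [lebesgue, (MeasurableEmbedding.subtype_coe (measurableSet_simplex m)).comap_apply,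
    Set.image_univ, Subtype.range_coe]
  refine (measure_mono (t := Set.Icc (0 : Fin m → ℝ) 1) ?_).trans (le_of_eq ?_)
  · exact fun y hy => ⟨fun i => (hy.1 i).1, fun i => (hy.1 i).2⟩
  · rw [Real.volume_Icc_pi]
    simp

/-- A continuous function on a compact set has a quadratic modulus of continuity up to an
arbitrarily small error. -/
theorem exists_quadratic_modulus {m p : ℕ} {X : Set (Fin p → ℝ)} (hX : IsCompact X)
    {g : X → simplex m → ℝ} (hg : Continuous fun a : simplex m × X => g a.2 a.1) {δ : ℝ}
    (hδ : 0 < δ) :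
    ∃ K : ℝ, 0 ≤ K ∧ ∀ x, ∀ z y : simplex m,
      |g x z - g x y| ≤ δ + K * ∑ i, ((z : Fin m → ℝ) i - (y : Fin m → ℝ) i) ^ 2 := by
  have : CompactSpace X := isCompact_iff_compactSpace.1 hX
  have : CompactSpace (simplex m) := isCompact_iff_compactSpace.1 (isCompact_simplex m)
  have huc := CompactSpace.uniformContinuous_of_continuous hg
  obtain ⟨η, hη, hη'⟩ := Metric.uniformContinuous_iff.1 huc δ hδ
  obtain ⟨M, hM⟩ := isCompact_univ.exists_bound_of_continuousOn hg.continuousOn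
  have hM' : ∀ x y, |g x y| ≤ |M| := fun x y => (hM (y, x) (Set.mem_univ _)).trans (le_abs_self M)
  refine ⟨2 * |M| / η ^ 2, by positivity, fun x z y => ?_⟩
  have hsum : 0 ≤ ∑ i, ((z : Fin m → ℝ) i - (y : Fin m → ℝ) i) ^ 2 :=
    Finset.sum_nonneg fun i _ => sq_nonneg _
  by_cases hzy : dist z y < η
  · have h1 : dist (z, x) (y, x) < η := by simpa [Prod.dist_eq] using hzy
    have h2 := (hη' h1).le
    rw [Real.dist_eq] at h2
    have : 0 ≤ 2 * |M| / η ^ 2 * ∑ i, ((z : Fin m → ℝ) i - (y : Fin m → ℝ) i) ^ 2 := by positivity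
    linarith
  · have h1 : η ^ 2 ≤ ∑ i, ((z : Fin m → ℝ) i - (y : Fin m → ℝ) i) ^ 2 := by
      by_contra hcon
      push Not at hcon
      refine hzy ?_
      rw [Subtype.dist_eq, dist_pi_lt_iff hη]
      intro i
      rw [Real.dist_eq]
      refine abs_lt_of_sq_lt_sq ?_ hη.le
      exact (Finset.single_le_sum (f := fun i => ((z : Fin m → ℝ) i - (y : Fin m → ℝ) i) ^ 2)
        (fun j _ => sq_nonneg _) (Finset.mem_univ i)).trans_lt hcon
    have h2 : |g x z - g x y| ≤ 2 * |M| := by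
      have := abs_sub (g x z) (g x y)
      linarith [hM' x z, hM' x y]
    have h3 : 2 * |M| ≤ 2 * |M| / η ^ 2 * ∑ i, ((z : Fin m → ℝ) i - (y : Fin m → ℝ) i) ^ 2 := by
      calc 2 * |M| = 2 * |M| / η ^ 2 * η ^ 2 := by field_simp
        _ ≤ _ := by gcongr
    linarith

/-! ### Approximation of the true density by finite mixtures -/

/-- A finite mixture of Dirichlet densities `dir(· ∣ α(k, ⌈k c_j⌉))`, `j < N`, with continuous
weights `W_j(x)` of total mass less than one, which stays above `t q₀` even after every weight is
lowered by `ρ`, and whose Dirichlet parameters do not change when the atoms `c_j` are moved by less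
than `r`. -/
structure FiniteMixtureBelow {m p : ℕ} {X : Set (Fin p → ℝ)} (q₀ : X → simplex m → ℝ)
    (t : ℝ) where
  /-- the degree -/
  k : ℕ
  /-- the number of components -/
  N : ℕ
  /-- the weights -/
  W : ℕ → X → ℝ
  /-- the atoms -/
  c : ℕ → Fin m → ℝ
  /-- the distance by which the atoms can be moved -/
  r : ℝ
  /-- the amount by which the weights can be lowered -/
  ρ : ℝ
  one_le_k : 1 ≤ k
  one_le_N : 1 ≤ N
  r_pos : 0 < r
  ρ_pos : 0 < ρ
  continuous_W : ∀ j, Continuous (W j)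
  W_nonneg : ∀ j x, 0 ≤ W j x
  sum_W_lt_one : ∀ x, ∑ j ∈ Finset.range N, W j x < 1
  c_mem : ∀ j, c j ∈ simplexPos m
  param_eq : ∀ j θ, ‖θ - c j‖ < r → dirichletParam k θ = dirichletParam k (c j)
  le_sum : ∀ x (y : simplex m), t * q₀ x y ≤ ∑ j ∈ Finset.range N,
    (W j x - ρ) * dirichletDensity (dirichletParam k (c j)) (y : Fin m → ℝ)

/-- A sum over a nonempty finite type, written as a sum over an initial segment of `ℕ`. -/
theorem exists_enumeration (ι : Type*) [Fintype ι] [Nonempty ι] :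
    ∃ idx : ℕ → ι, ∀ F : ι → ℝ, ∑ j ∈ Finset.range (Fintype.card ι), F (idx j) = ∑ i, F i := by
  have hpos : 0 < Fintype.card ι := Fintype.card_pos
  let e := Fintype.equivFin ι
  refine ⟨fun j => e.symm ⟨j % Fintype.card ι, Nat.mod_lt _ hpos⟩, fun F => ?_⟩
  rw [Finset.sum_range, ← e.symm.sum_comp]
  exact Finset.sum_congr rfl fun i _ =>
    congrArg (fun i => F (e.symm i)) (Fin.ext (Nat.mod_eq_of_lt i.2))

/-- The weights of a pointwise bounded mixture of Dirichlet densities are bounded by the integral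
of the bound. -/
theorem sum_mixtureWeights_le {m : ℕ} {ι : Type*} [Fintype ι] {U : ι → ℝ} (hU : ∀ i, 0 ≤ U i)
    {a : ι → Fin (m + 1) → ℕ} {f : simplex m → ℝ} (hf : Measurable f) (hf0 : ∀ y, 0 ≤ f y)
    (hf1 : ∫⁻ y, ENNReal.ofReal (f y) ∂(lebesgue m) = 1) {δ : ℝ} (hδ : 0 ≤ δ)
    (hle : ∀ y : simplex m, ∑ i, U i * dirichletDensity (fun l => (a i l : ℝ) + 1)
      (y : Fin m → ℝ) ≤ f y + δ) :
    ∑ i, U i ≤ 1 + δ := by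
  have h1 : ENNReal.ofReal (∑ i, U i) ≤ ENNReal.ofReal (1 + δ) := by
    calc ENNReal.ofReal (∑ i, U i) = ∑ i, ∫⁻ y, ENNReal.ofReal (U i) * ENNReal.ofReal
          (dirichletDensity (fun l => (a i l : ℝ) + 1) (y : Fin m → ℝ)) ∂(lebesgue m) := by
          rw [ENNReal.ofReal_sum_of_nonneg fun i _ => hU i]
          refine Finset.sum_congr rfl fun i _ => ?_
          rw [lintegral_const_mul' _ _ ENNReal.ofReal_ne_top,
            lintegral_dirichletDensity fun l => by positivity, mul_one]
      _ = ∫⁻ y, ∑ i, ENNReal.ofReal (U i) * ENNReal.ofReal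
          (dirichletDensity (fun l => (a i l : ℝ) + 1) (y : Fin m → ℝ)) ∂(lebesgue m) := by
          rw [lintegral_finsetSum]
          exact fun i _ => ((measurable_dirichletDensity _).comp
            measurable_subtype_coe).ennreal_ofReal.const_mul _
      _ ≤ ∫⁻ y, (ENNReal.ofReal (f y) + ENNReal.ofReal δ) ∂(lebesgue m) := by
          refine lintegral_mono fun y => ?_
          dsimp only
          simp_rw [← ENNReal.ofReal_mul (hU _)]
          rw [← ENNReal.ofReal_sum_of_nonneg fun i _ => mul_nonneg (hU i)
            (dirichletDensity_natCast_add_one_nonneg _ y.2), ← ENNReal.ofReal_add (hf0 y) hδ]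
          exact ENNReal.ofReal_le_ofReal (hle y)
      _ ≤ 1 + ENNReal.ofReal δ := by
          rw [lintegral_add_left hf.ennreal_ofReal, hf1, lintegral_const]
          gcongr
          exact mul_le_of_le_one_right' (lebesgue_univ_le_one m)
      _ = ENNReal.ofReal (1 + δ) := by
          rw [ENNReal.ofReal_add zero_le_one hδ, ENNReal.ofReal_one]
  exact (ENNReal.ofReal_le_ofReal_iff (by linarith)).1 h1

/-- The approximating mixture is the Bernstein polynomial of `q₀ + δ`, rescaled so that its total
mass is less than one. -/
theorem nonempty_finiteMixtureBelow {m p : ℕ} (hm : 1 ≤ m) {X : Set (Fin p → ℝ)}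
    (hX : IsCompact X) {q₀ : X → simplex m → ℝ} (hq₀ : IsContinuousDensityFamily q₀) {t : ℝ}
    (ht0 : 0 < t) (ht1 : t < 1) : Nonempty (FiniteMixtureBelow q₀ t) := by
  -- the choice of `δ` for which `t (1 + 3δ/2) < 1`
  set δ : ℝ := (1 / t - 1) / 2 with hδdef
  have hδ : 0 < δ := by
    have : 1 < 1 / t := by rw [lt_div_iff₀ ht0]; linarith
    linarith
  have htδ : t * (1 + 3 * δ / 2) < 1 := by
    have : t * (1 + 2 * δ) = 1 := by rw [hδdef]; field_simp; ring
    nlinarith [mul_pos ht0 hδ]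
  obtain ⟨K, hK, hKq⟩ := exists_quadratic_modulus hX hq₀.continuous (δ := δ / 4) (by positivity)
  obtain ⟨n, hn⟩ := exists_nat_gt (max 1 (4 * (K * m) / δ))
  have hn1 : 1 ≤ n := by exact_mod_cast ((le_max_left _ _).trans hn.le)
  have hn0 : (0 : ℝ) < n := by exact_mod_cast hn1
  have hnK : K * (m / n) ≤ δ / 4 := by
    have h1 : 4 * (K * m) / δ < n := (le_max_right _ _).trans_lt hn
    rw [div_lt_iff₀ hδ] at h1
    rw [← mul_div_assoc, div_le_iff₀ hn0]
    linarith
  let U : (Fin n → Fin (m + 1)) → X → ℝ := fun w x =>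
    (q₀ x ⟨wordNode w, wordNode_mem w⟩ + δ) * wordConst w
  let dir : (Fin n → Fin (m + 1)) → simplex m → ℝ := fun w y =>
    dirichletDensity (fun a => (letterCount w a : ℝ) + 1) (y : Fin m → ℝ)
  have hU0 : ∀ w x, 0 ≤ U w x := fun w x =>
    mul_nonneg (add_nonneg (hq₀.nonneg _ _) hδ.le) (wordConst_pos w).le
  have hbern : ∀ x (y : simplex m), |∑ w, U w x * dir w y - (q₀ x y + δ)| ≤ δ / 2 := by
    intro x y
    have h1 := abs_bernstein_sub_le hn1 hK (G := fun y => q₀ x y + δ) (δ := δ / 4)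
      (fun z y => by rw [add_sub_add_right_eq_sub]; exact hKq x z y) y
    have h2 : ∀ w : Fin n → Fin (m + 1), (∏ s, barycentric (y : Fin m → ℝ) (w s)) *
        (q₀ x ⟨wordNode w, wordNode_mem w⟩ + δ) = U w x * dir w y := fun w => by
      rw [prod_barycentric_eq]
      simp only [U, dir]
      ring
    simp_rw [h2] at h1
    linarith
  have hUsum : ∀ x, ∑ w, U w x ≤ 1 + 3 * δ / 2 := fun x =>
    sum_mixtureWeights_le (fun w => hU0 w x) (a := fun w => letterCount w) (f := q₀ x)
      (hq₀.continuous.comp (continuous_id.prodMk continuous_const)).measurable (hq₀.nonneg x)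
      (hq₀.lintegral_eq_one x) (by positivity) fun y => by
        have := (abs_le.1 (hbern x y)).2
        simp only [dir] at this
        linarith
  set M : ℝ := (Fintype.card (Fin n → Fin (m + 1)) : ℝ) * ((n + m).factorial : ℝ) with hM
  have hMpos : 0 < M := mul_pos (by exact_mod_cast Fintype.card_pos)
    (by exact_mod_cast Nat.factorial_pos _)
  have hdirsum : ∀ y, ∑ w, dir w y ≤ M := by
    intro y
    calc ∑ w, dir w y ≤ ∑ _w : Fin n → Fin (m + 1), ((n + m).factorial : ℝ) := by
          refine Finset.sum_le_sum fun w _ => ?_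
          have := dirichletDensity_natCast_add_one_le (letterCount w) y.2
          rwa [sum_letterCount] at this
      _ = M := by
          rw [Finset.sum_const, Finset.card_univ, nsmul_eq_mul]
  obtain ⟨idx, hidx⟩ := exists_enumeration (Fin n → Fin (m + 1))
  have hparam : ∀ w : Fin n → Fin (m + 1), dirichletParam (n + 1) (cellPoint w) =
      fun a => (letterCount w a : ℝ) + 1 := fun w =>
    dirichletParam_eq_of_near hm w (by rw [sub_self, norm_zero]; positivity)
  exact ⟨{
    k := n + 1
    N := Fintype.card (Fin n → Fin (m + 1))
    W := fun j x => t * U (idx j) x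
    c := fun j => cellPoint (idx j)
    r := 1 / (((m : ℝ) + 1) * (n + 1))
    ρ := t * (δ / 2) / M
    one_le_k := by omega
    one_le_N := Fintype.card_pos
    r_pos := by positivity
    ρ_pos := by positivity
    continuous_W := fun j => continuous_const.mul
      (((hq₀.continuous.comp (continuous_const.prodMk continuous_id)).add continuous_const).mul
        continuous_const)
    W_nonneg := fun j x => mul_nonneg ht0.le (hU0 _ x)
    sum_W_lt_one := fun x => by
      rw [hidx fun w => t * U w x, ← Finset.mul_sum]
      exact (mul_le_mul_of_nonneg_left (hUsum x) ht0.le).trans_lt htδ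
    c_mem := fun j => cellPoint_mem _
    param_eq := fun j θ hθ => by rw [dirichletParam_eq_of_near hm _ hθ, hparam]
    le_sum := fun x y => by
      simp_rw [hparam]
      rw [hidx fun w => (t * U w x - t * (δ / 2) / M) *
        dirichletDensity (fun a => (letterCount w a : ℝ) + 1) (y : Fin m → ℝ)]
      have h1 : ∑ w, (t * U w x - t * (δ / 2) / M) *
          dirichletDensity (fun a => (letterCount w a : ℝ) + 1) (y : Fin m → ℝ) =
          t * ∑ w, U w x * dir w y - t * (δ / 2) / M * ∑ w, dir w y := by
        rw [Finset.mul_sum, Finset.mul_sum, ← Finset.sum_sub_distrib]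
        exact Finset.sum_congr rfl fun w _ => by simp only [dir]; ring
      have h2 : t * (δ / 2) / M * ∑ w, dir w y ≤ t * (δ / 2) := by
        calc _ ≤ t * (δ / 2) / M * M := by
              gcongr
              exact hdirsum y
          _ = _ := by field_simp
      have h3 := mul_le_mul_of_nonneg_left (abs_le.1 (hbern x y)).1 ht0.le
      rw [h1]
      linarith }⟩

/-! ### Stick-breaking with prescribed weights -/

/-- The stick-breaking fractions that produce the weights `W`. -/
def stickFraction (W : ℕ → ℝ) (j : ℕ) : ℝ :=
  W j / (1 - ∑ l ∈ Finset.range j, W l)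

section StickFraction

variable {W : ℕ → ℝ} {N : ℕ}

theorem sum_range_lt_one (hW : ∀ j, 0 ≤ W j) (hsum : ∑ j ∈ Finset.range N, W j < 1) {j : ℕ}
    (hj : j ≤ N) : ∑ l ∈ Finset.range j, W l < 1 :=
  (Finset.sum_le_sum_of_subset_of_nonneg (Finset.range_mono hj) fun i _ _ => hW i).trans_lt hsum

theorem stickFraction_mem (hW : ∀ j, 0 ≤ W j) (hsum : ∑ j ∈ Finset.range N, W j < 1) {j : ℕ}
    (hj : j < N) : stickFraction W j ∈ Set.Icc (0 : ℝ) 1 := by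
  have h1 := sum_range_lt_one hW hsum hj.le
  have h2 := sum_range_lt_one hW hsum (Nat.succ_le_of_lt hj)
  rw [Finset.sum_range_succ] at h2
  exact ⟨div_nonneg (hW j) (by linarith), div_le_one_of_le₀ (by linarith) (by linarith)⟩

theorem stickWeight_stickFraction (hW : ∀ j, 0 ≤ W j) (hsum : ∑ j ∈ Finset.range N, W j < 1)
    {j : ℕ} (hj : j < N) : stickWeight (stickFraction W) j = W j := by
  have hprod : ∀ i ≤ N, ∏ l ∈ Finset.range i, (1 - stickFraction W l) =
      1 - ∑ l ∈ Finset.range i, W l := by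
    intro i
    induction i with
    | zero => simp
    | succ i ih =>
      intro hi
      have h1 := sum_range_lt_one hW hsum (Nat.le_of_succ_le hi)
      have h2 : 1 - ∑ l ∈ Finset.range i, W l ≠ 0 := by linarith
      rw [Finset.prod_range_succ, ih (Nat.le_of_succ_le hi), Finset.sum_range_succ, stickFraction]
      field_simp
      ring
  have h1 := sum_range_lt_one hW hsum hj.le
  have h2 : 1 - ∑ l ∈ Finset.range j, W l ≠ 0 := by linarith
  rw [stickWeight, hprod j hj.le, stickFraction, div_mul_cancel₀ _ h2]

end StickFraction

theorem abs_prod_one_sub_sub_le {V V' : ℕ → ℝ} {j : ℕ} (hV : ∀ l < j, V l ∈ Set.Icc (0 : ℝ) 1)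
    (hV' : ∀ l < j, V' l ∈ Set.Icc (0 : ℝ) 1) :
    |∏ l ∈ Finset.range j, (1 - V l) - ∏ l ∈ Finset.range j, (1 - V' l)| ≤
      ∑ l ∈ Finset.range j, |V l - V' l| := by
  induction j with
  | zero => simp
  | succ j ih =>
    have ih' := ih (fun l hl => hV l (by omega)) (fun l hl => hV' l (by omega))
    rw [Finset.prod_range_succ, Finset.prod_range_succ, Finset.sum_range_succ]
    set A := ∏ l ∈ Finset.range j, (1 - V l)
    set B := ∏ l ∈ Finset.range j, (1 - V' l) with hB
    have hB0 : 0 ≤ B := Finset.prod_nonneg fun l hl =>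
      sub_nonneg.2 (hV' l (by have := Finset.mem_range.1 hl; omega)).2
    have hB1 : B ≤ 1 := Finset.prod_le_one
      (fun l hl => sub_nonneg.2 (hV' l (by have := Finset.mem_range.1 hl; omega)).2)
      fun l hl => sub_le_self _ (hV' l (by have := Finset.mem_range.1 hl; omega)).1
    have h1 := hV j (by omega)
    have e : A * (1 - V j) - B * (1 - V' j) = (A - B) * (1 - V j) + B * (V' j - V j) := by ring
    rw [e]
    refine (abs_add_le _ _).trans (add_le_add ?_ ?_)
    · rw [abs_mul, abs_of_nonneg (sub_nonneg.2 h1.2)]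
      exact (mul_le_of_le_one_right (abs_nonneg _) (by linarith [h1.1])).trans ih'
    · rw [abs_mul, abs_of_nonneg hB0, abs_sub_comm]
      exact mul_le_of_le_one_left (abs_nonneg _) hB1

theorem abs_stickWeight_sub_le {V V' : ℕ → ℝ} {j : ℕ} (hV : ∀ l ≤ j, V l ∈ Set.Icc (0 : ℝ) 1)
    (hV' : ∀ l ≤ j, V' l ∈ Set.Icc (0 : ℝ) 1) :
    |stickWeight V j - stickWeight V' j| ≤ ∑ l ∈ Finset.range (j + 1), |V l - V' l| := by
  have h := abs_prod_one_sub_sub_le (j := j) (fun l hl => hV l hl.le) (fun l hl => hV' l hl.le)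
  rw [stickWeight, stickWeight, Finset.sum_range_succ]
  set A := ∏ l ∈ Finset.range j, (1 - V l)
  set B := ∏ l ∈ Finset.range j, (1 - V' l)
  have hB0 : 0 ≤ B := Finset.prod_nonneg fun l hl =>
    sub_nonneg.2 (hV' l (Finset.mem_range.1 hl).le).2
  have hB1 : B ≤ 1 := Finset.prod_le_one
    (fun l hl => sub_nonneg.2 (hV' l (Finset.mem_range.1 hl).le).2)
    fun l hl => sub_le_self _ (hV' l (Finset.mem_range.1 hl).le).1
  have h1 := hV j le_rfl
  have e : V j * A - V' j * B = V j * (A - B) + (V j - V' j) * B := by ring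
  rw [e]
  refine (abs_add_le _ _).trans (add_le_add ?_ ?_)
  · rw [abs_mul, abs_of_nonneg h1.1]
    exact (mul_le_of_le_one_left (abs_nonneg _) h1.2).trans h
  · rw [abs_mul, abs_of_nonneg hB0]
    exact mul_le_of_le_one_right (abs_nonneg _) hB1

theorem sub_le_stickWeight {W V : ℕ → ℝ} {N : ℕ} (hW : ∀ j, 0 ≤ W j)
    (hsum : ∑ j ∈ Finset.range N, W j < 1) (hV : ∀ j, V j ∈ Set.Icc (0 : ℝ) 1) {ρ : ℝ}
    (hnear : ∀ j < N, |V j - stickFraction W j| < ρ / (N + 1)) {j : ℕ} (hj : j < N) :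
    W j - ρ ≤ stickWeight V j := by
  have hN : (0 : ℝ) < (N : ℝ) + 1 := by positivity
  have hρ : 0 < ρ / (N + 1) := (abs_nonneg _).trans_lt (hnear j hj)
  have h1 := abs_stickWeight_sub_le (V := V) (V' := stickFraction W) (j := j) (fun l _ => hV l)
    (fun l hl => stickFraction_mem hW hsum (hl.trans_lt hj))
  rw [stickWeight_stickFraction hW hsum hj] at h1
  have h2 : ∑ l ∈ Finset.range (j + 1), |V l - stickFraction W l| ≤ ρ := by
    calc _ ≤ ∑ _l ∈ Finset.range (j + 1), ρ / (N + 1) := Finset.sum_le_sum fun l hl =>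
          (hnear l (by have := Finset.mem_range.1 hl; omega)).le
      _ = (j + 1 : ℕ) * (ρ / (N + 1)) := by simp
      _ ≤ (N + 1) * (ρ / (N + 1)) := by
          gcongr
          exact_mod_cast Nat.succ_le_succ hj.le
      _ = ρ := by field_simp
  linarith [(abs_le.1 (h1.trans h2)).1]

/-! ### Neighborhoods of targets on which the mixture dominates the true density -/

section Targets

variable {m p : ℕ} {X : Set (Fin p → ℝ)} {q₀ : X → simplex m → ℝ} {t : ℝ}

/-- If, for `j < N`, the weights `V_j` are `ε`-close to `v_j(x)` and the atoms `θ_j` are `r`-close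
to `F_j(x)`, then the mixture of degree `k` is at least `t q₀(· ∣ x)`. -/
def IsDominatingTarget (q₀ : X → simplex m → ℝ) (t : ℝ) (k N : ℕ) (v : ℕ → X → ℝ) (ε : ℝ)
    (F : ℕ → X → Fin m → ℝ) (r : ℝ) : Prop :=
  ∀ (x : X) (y : simplex m) (V : ℕ → ℝ) (θ : ℕ → Fin m → ℝ),
    (∀ j, V j ∈ Set.Icc (0 : ℝ) 1) → (∀ j, θ j ∈ simplexPos m) →
    (∀ j < N, ‖V j - v j x‖ < ε) → (∀ j < N, ‖θ j - F j x‖ < r) →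
    t * q₀ x y ≤ mixtureDensity k V θ y

/-- Targets with constant atoms: the weights carry the dependence on the predictor. -/
theorem FiniteMixtureBelow.isDominatingTarget_constAtoms (hm : 1 ≤ m)
    (A : FiniteMixtureBelow q₀ t) :
    IsDominatingTarget q₀ t A.k A.N (fun j x => stickFraction (fun i => A.W i x) j)
      (A.ρ / (A.N + 1)) (fun j _ => A.c j) A.r := by
  intro x y V θ hV hθ hVn hθn
  refine (A.le_sum x y).trans (le_trans (Finset.sum_le_sum fun j hj => ?_)
    (sum_range_le_mixtureDensity hm A.one_le_k hV hθ y A.N))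
  have hj' := Finset.mem_range.1 hj
  rw [A.param_eq j _ (hθn j hj')]
  exact mul_le_mul_of_nonneg_right
    (sub_le_stickWeight (W := fun i => A.W i x) (fun i => A.W_nonneg i x) (A.sum_W_lt_one x) hV
      hVn hj') (dirichletDensity_dirichletParam_nonneg hm A.one_le_k (A.c_mem j) y.2)

theorem convex_simplexPos (m : ℕ) : Convex ℝ (simplexPos m) := by
  intro a ha b hb s s' hs hs' hss
  have hpos : ∀ i, 0 < (s • a + s' • b) i := by
    intro i
    simp only [Pi.add_apply, Pi.smul_apply, smul_eq_mul]
    rcases hs.eq_or_lt with h | h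
    · have : s' = 1 := by linarith
      simp [← h, this, hb.2 i]
    · exact add_pos_of_pos_of_nonneg (mul_pos h (ha.2 i)) (mul_nonneg hs' (hb.2 i).le)
  have hsum : ∑ i, (s • a + s' • b) i ≤ 1 := by
    simp only [Pi.add_apply, Pi.smul_apply, smul_eq_mul]
    rw [Finset.sum_add_distrib, ← Finset.mul_sum, ← Finset.mul_sum]
    nlinarith [ha.1.2, hb.1.2]
  exact ⟨⟨fun i => ⟨(hpos i).le,
    (Finset.single_le_sum (fun j _ => (hpos j).le) (Finset.mem_univ i)).trans hsum⟩, hsum⟩, hpos⟩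

/-- A ramp in `u`: zero up to `S_i - δ`, one from `S_i` on, where `S_i = ∑_{l < i} W_l`; by
convention it vanishes for `i ≥ N`. -/
def ramp (W : ℕ → ℝ) (N : ℕ) (δ u : ℝ) (i : ℕ) : ℝ :=
  if i < N then max 0 (min 1 ((u - ∑ l ∈ Finset.range i, W l + δ) / δ)) else 0

/-- A path which rests at the points `c_0, …, c_{N-1}` in turn: at `c_i` when `u` is in
`[S_i, S_{i+1} - δ]`, where `S_i = ∑_{l < i} W_l`. -/
def restingPath {m : ℕ} (W : ℕ → ℝ) (N : ℕ) (c : ℕ → Fin m → ℝ) (δ u : ℝ) : Fin m → ℝ :=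
  ∑ i ∈ Finset.range N, (ramp W N δ u i - ramp W N δ u (i + 1)) • c i

section Path

variable {W : ℕ → ℝ} {N : ℕ} {c : ℕ → Fin m → ℝ} {δ u : ℝ}

theorem ramp_succ_le (hW : ∀ j, 0 ≤ W j) (hδ : 0 < δ) (i : ℕ) :
    ramp W N δ u (i + 1) ≤ ramp W N δ u i := by
  unfold ramp
  by_cases h1 : i + 1 < N
  · have h0 : i < N := by omega
    rw [if_pos h1, if_pos h0, Finset.sum_range_succ]
    gcongr
    linarith [hW i]
  · rw [if_neg h1]
    split_ifs
    · exact le_max_left _ _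
    · exact le_rfl

theorem ramp_eq_one (hδ : 0 < δ) {i : ℕ} (hi : i < N) (hu : ∑ l ∈ Finset.range i, W l ≤ u) :
    ramp W N δ u i = 1 := by
  rw [ramp, if_pos hi, min_eq_left, max_eq_right zero_le_one]
  rw [le_div_iff₀ hδ]
  linarith

theorem ramp_eq_zero (hδ : 0 < δ) {i : ℕ} (hu : u ≤ ∑ l ∈ Finset.range i, W l - δ) :
    ramp W N δ u i = 0 := by
  unfold ramp
  split_ifs
  · refine max_eq_left ((min_le_right _ _).trans ?_)
    exact div_nonpos_of_nonpos_of_nonneg (by linarith) hδ.le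
  · rfl

theorem restingPath_mem (hW : ∀ j, 0 ≤ W j) (hδ : 0 < δ) (hN : 1 ≤ N) (hu : 0 ≤ u)
    (hc : ∀ i, c i ∈ simplexPos m) : restingPath W N c δ u ∈ simplexPos m := by
  refine (convex_simplexPos m).sum_mem (fun i _ => sub_nonneg.2 (ramp_succ_le hW hδ i)) ?_
    fun i _ => hc i
  rw [Finset.sum_range_sub', ramp_eq_one hδ (by omega) (by simpa using hu)]
  simp [ramp]

theorem restingPath_eq (hW : ∀ j, 0 ≤ W j) (hδ : 0 < δ) {i : ℕ} (hi : i < N)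
    (h1 : ∑ l ∈ Finset.range i, W l ≤ u) (h2 : u ≤ ∑ l ∈ Finset.range (i + 1), W l - δ) :
    restingPath W N c δ u = c i := by
  have hmono : ∀ {a b : ℕ}, a ≤ b → ∑ l ∈ Finset.range a, W l ≤ ∑ l ∈ Finset.range b, W l :=
    fun hab => Finset.sum_le_sum_of_subset_of_nonneg (Finset.range_mono hab) fun i _ _ => hW i
  have hone : ∀ l ≤ i, ramp W N δ u l = 1 := fun l hl =>
    ramp_eq_one hδ (by omega) ((hmono hl).trans h1)
  have hzero : ∀ l, i + 1 ≤ l → ramp W N δ u l = 0 := fun l hl =>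
    ramp_eq_zero hδ (by linarith [hmono hl])
  rw [restingPath, Finset.sum_eq_single i]
  · rw [hone i le_rfl, hzero (i + 1) le_rfl]
    simp
  · intro l _ hl
    rcases lt_or_gt_of_ne hl with h | h
    · rw [hone l h.le, hone (l + 1) h]
      simp
    · rw [hzero l h, hzero (l + 1) (by omega)]
      simp
  · intro h
    exact absurd (Finset.mem_range.2 hi) h

theorem continuous_restingPath {W : ℕ → X → ℝ} (hW : ∀ j, Continuous (W j)) :
    Continuous fun x => restingPath (fun j => W j x) N c δ u := by
  unfold restingPath
  refine continuous_finsetSum _ fun i _ => ?_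
  have hr : ∀ l, Continuous fun x => ramp (fun j => W j x) N δ u l := by
    intro l
    unfold ramp
    split_ifs
    · have : Continuous fun x => ∑ j ∈ Finset.range l, W j x :=
        continuous_finsetSum _ fun j _ => hW j
      fun_prop
    · exact continuous_const
  exact ((hr i).sub (hr (i + 1))).smul continuous_const

end Path

/-- The number of grid points `j / N` in an interval of length `b - a` is at least
`N (b - a) - 1`. -/
theorem le_card_grid {N : ℕ} (hN : 1 ≤ N) {a b : ℝ} (ha : 0 ≤ a) (hb : b < 1) :
    (N : ℝ) * (b - a) - 1 ≤
      (((Finset.range N).filter fun j : ℕ => a ≤ (j : ℝ) / N ∧ (j : ℝ) / N ≤ b).card : ℝ) := by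
  have hN0 : (0 : ℝ) < N := by exact_mod_cast hN
  rcases lt_or_ge b a with hab | hab
  · have h1 : (N : ℝ) * (b - a) ≤ 0 := mul_nonpos_of_nonneg_of_nonpos hN0.le (by linarith)
    have h2 : (0 : ℝ) ≤ (((Finset.range N).filter
      fun j : ℕ => a ≤ (j : ℝ) / N ∧ (j : ℝ) / N ≤ b).card : ℝ) := Nat.cast_nonneg _
    linarith
  have hNb : 0 ≤ N * b := mul_nonneg hN0.le (ha.trans hab)
  have hsub : Finset.Ico ⌈N * a⌉₊ (⌊N * b⌋₊ + 1) ⊆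
      (Finset.range N).filter fun j : ℕ => a ≤ (j : ℝ) / N ∧ (j : ℝ) / N ≤ b := by
    intro j hj
    rw [Finset.mem_Ico, Nat.lt_succ_iff] at hj
    have h1 : N * a ≤ j := Nat.ceil_le.1 hj.1
    have h2 : (j : ℝ) ≤ N * b := (Nat.le_floor_iff hNb).1 hj.2
    have h3 : (j : ℝ) < N := h2.trans_lt (by nlinarith)
    rw [Finset.mem_filter, Finset.mem_range, le_div_iff₀ hN0, div_le_iff₀ hN0]
    exact ⟨by exact_mod_cast h3, by linarith, by linarith⟩
  have hcard := Finset.card_le_card hsub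
  rw [Nat.card_Ico] at hcard
  have h1 : (⌊N * b⌋₊ : ℝ) + 1 - ⌈N * a⌉₊ ≤ ((⌊N * b⌋₊ + 1 - ⌈N * a⌉₊ : ℕ) : ℝ) := by
    rw [sub_le_iff_le_add]
    exact_mod_cast Nat.sub_le_iff_le_add.1 le_rfl
  have h2 : ((⌊N * b⌋₊ + 1 - ⌈N * a⌉₊ : ℕ) : ℝ) ≤ _ := Nat.cast_le.2 hcard
  have h3 := Nat.lt_floor_add_one (N * b)
  have h4 := Nat.ceil_lt_add_one (mul_nonneg hN0.le ha)
  linarith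

/-- Targets with constant weights: `M` equally weighted atoms travel between the atoms of the given
mixture, in such a way that at each predictor value roughly a fraction `W_i(x)` of them rests at
the `i`-th one.  Only a lower bound is needed, so the atoms in transit can be ignored. -/
theorem FiniteMixtureBelow.exists_isDominatingTarget_constWeights (hm : 1 ≤ m)
    (A : FiniteMixtureBelow q₀ t) :
    ∃ (M : ℕ) (v : ℕ → ℝ) (ε : ℝ) (F : ℕ → X → Fin m → ℝ),
      (∀ j < M, v j ∈ Set.Icc (0 : ℝ) 1) ∧ 0 < ε ∧ (∀ j, Continuous (F j)) ∧
      (∀ j x, F j x ∈ simplexPos m) ∧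
      IsDominatingTarget q₀ t A.k M (fun j _ => v j) ε F A.r := by
  set δ : ℝ := A.ρ / 2 with hδdef
  have hδ : 0 < δ := half_pos A.ρ_pos
  obtain ⟨M, hM⟩ := exists_nat_gt (max 1 (6 / A.ρ))
  have hM1 : 1 ≤ M := by exact_mod_cast ((le_max_left _ _).trans hM.le)
  have hM0 : (0 : ℝ) < M := by exact_mod_cast hM1
  have hMρ : 6 / A.ρ < M := (le_max_right _ _).trans_lt hM
  have hW0 : ∀ j : ℕ, 0 ≤ (fun _ : ℕ => 1 / ((M : ℝ) + 1)) j := fun j => by positivity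
  have hWs : ∑ j ∈ Finset.range M, (fun _ : ℕ => 1 / ((M : ℝ) + 1)) j < 1 := by
    simp only [Finset.sum_const, Finset.card_range, nsmul_eq_mul]
    rw [mul_one_div, div_lt_one (by positivity)]
    linarith
  refine ⟨M, stickFraction fun _ => 1 / ((M : ℝ) + 1), 1 / ((M : ℝ) + 1) ^ 2 / (M + 1),
    fun j x => restingPath (fun i => A.W i x) A.N A.c δ (j / M),
    fun j hj => stickFraction_mem hW0 hWs hj, by positivity,
    fun j => continuous_restingPath A.continuous_W,
    fun j x => restingPath_mem (fun i => A.W_nonneg i x) hδ A.one_le_N (by positivity) A.c_mem, ?_⟩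
  intro x y V θ hV hθ hVn hθn
  set β : ℝ := 1 / ((M : ℝ) + 1) - 1 / ((M : ℝ) + 1) ^ 2 with hβdef
  have hβ : β = M / ((M : ℝ) + 1) ^ 2 := by
    rw [hβdef]
    field_simp
    ring
  have hβ0 : 0 ≤ β := by rw [hβ]; positivity
  let S : ℕ → ℝ := fun i => ∑ l ∈ Finset.range i, A.W l x
  have hSmono : ∀ {a b : ℕ}, a ≤ b → S a ≤ S b := fun hab =>
    Finset.sum_le_sum_of_subset_of_nonneg (Finset.range_mono hab) fun i _ _ => A.W_nonneg i x
  let J : ℕ → Finset ℕ := fun i => (Finset.range M).filter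
    fun j : ℕ => S i ≤ (j : ℝ) / M ∧ (j : ℝ) / M ≤ S (i + 1) - δ
  let D : ℕ → ℝ := fun j => dirichletDensity (dirichletParam A.k (θ j)) (y : Fin m → ℝ)
  let D' : ℕ → ℝ := fun i => dirichletDensity (dirichletParam A.k (A.c i)) (y : Fin m → ℝ)
  have hD0 : ∀ j, 0 ≤ D j := fun j =>
    dirichletDensity_dirichletParam_nonneg hm A.one_le_k (hθ j) y.2
  have hD'0 : ∀ i, 0 ≤ D' i := fun i =>
    dirichletDensity_dirichletParam_nonneg hm A.one_le_k (A.c_mem i) y.2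
  have hDJ : ∀ i < A.N, ∀ j ∈ J i, D j = D' i := by
    intro i hi j hj
    obtain ⟨hjM, h1, h2⟩ := Finset.mem_filter.1 hj
    have h3 := hθn j (Finset.mem_range.1 hjM)
    dsimp only at h3
    rw [restingPath_eq (fun i => A.W_nonneg i x) hδ hi h1 h2] at h3
    simp only [D, D', A.param_eq i _ h3]
  have hdisj : ∀ i i', i < i' → Disjoint (J i) (J i') := by
    intro i i' hii
    rw [Finset.disjoint_left]
    intro j hj hj'
    have h1 := (Finset.mem_filter.1 hj).2.2
    have h2 := (Finset.mem_filter.1 hj').2.1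
    linarith [hSmono (show i + 1 ≤ i' from hii)]
  have hcount : ∀ i < A.N, A.W i x - A.ρ ≤ β * ((J i).card : ℝ) := by
    intro i hi
    have hS1 : S (i + 1) < 1 :=
      sum_range_lt_one (fun j => A.W_nonneg j x) (A.sum_W_lt_one x) hi
    have hS0 : 0 ≤ S i := Finset.sum_nonneg fun l _ => A.W_nonneg l x
    have hc := le_card_grid hM1 hS0 (b := S (i + 1) - δ) (by linarith)
    have hSW : S (i + 1) - δ - S i = A.W i x - δ := by
      simp only [S, Finset.sum_range_succ]
      ring
    rw [hSW] at hc
    have hWle : A.W i x ≤ 1 := by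
      have : S (i + 1) = S i + A.W i x := Finset.sum_range_succ _ _
      linarith
    have hMρ' : 6 ≤ A.ρ * (M + 1) := by
      rw [div_lt_iff₀ A.ρ_pos] at hMρ
      nlinarith [A.ρ_pos]
    have hW0 := A.W_nonneg i x
    have hmul := mul_le_mul_of_nonneg_left hc hβ0
    refine le_trans ?_ hmul
    rw [hβ, div_mul_eq_mul_div, le_div_iff₀ (by positivity), hδdef]
    have hρ := A.ρ_pos
    nlinarith [mul_le_mul_of_nonneg_right hMρ' (by positivity : (0 : ℝ) ≤ M + 1),
      mul_nonneg (sub_nonneg.2 hWle) (by positivity : (0 : ℝ) ≤ 2 * M + 1),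
      mul_nonneg hρ.le hM0.le]
  calc t * q₀ x y ≤ ∑ i ∈ Finset.range A.N, (A.W i x - A.ρ) * D' i := A.le_sum x y
    _ ≤ ∑ i ∈ Finset.range A.N, ∑ j ∈ J i, β * D j := by
        refine Finset.sum_le_sum fun i hi => ?_
        rw [Finset.sum_congr rfl fun j hj => by rw [hDJ i (Finset.mem_range.1 hi) j hj],
          Finset.sum_const, nsmul_eq_mul]
        calc _ ≤ β * ((J i).card : ℝ) * D' i :=
              mul_le_mul_of_nonneg_right (hcount i (Finset.mem_range.1 hi)) (hD'0 i)
          _ = _ := by ring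
    _ = ∑ j ∈ (Finset.range A.N).biUnion J, β * D j := by
        rw [Finset.sum_biUnion]
        intro i _ i' _ hii
        rcases lt_or_gt_of_ne hii with h | h
        · exact hdisj i i' h
        · exact (hdisj i' i h).symm
    _ ≤ ∑ j ∈ Finset.range M, β * D j := by
        refine Finset.sum_le_sum_of_subset_of_nonneg ?_ fun j _ _ => mul_nonneg hβ0 (hD0 j)
        exact Finset.biUnion_subset.2 fun i _ => Finset.filter_subset _ _
    _ ≤ ∑ j ∈ Finset.range M, stickWeight V j * D j := by
        refine Finset.sum_le_sum fun j hj => mul_le_mul_of_nonneg_right ?_ (hD0 j)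
        exact sub_le_stickWeight hW0 hWs hV hVn (Finset.mem_range.1 hj)
    _ ≤ mixtureDensity A.k V θ y := sum_range_le_mixtureDensity hm A.one_le_k hV hθ y M

end Targets

/-! ### Prior mass of the neighborhoods -/

section Tubes

variable {Ω : Type*} [MeasurableSpace Ω] {m p : ℕ} {X : Set (Fin p → ℝ)} {P : Measure Ω}

/-- The random function `ξ` is `ε`-close to `f` on every finite set of predictors with a
probability bounded below uniformly in that set.

The event that `ξ` is `ε`-close to `f` on all of `X` need not be measurable, and independence cannot
be applied to it.  The likelihood of a sample only involves the finitely many observed predictors,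
and the events below are measurable. -/
def ChargesTubes {E : Type*} [NormedAddCommGroup E] (P : Measure Ω) (ξ : X → Ω → E) (f : X → E)
    (ε : ℝ) : Prop :=
  ∃ c : ℝ≥0∞, c ≠ 0 ∧ ∀ D : Finset X, c ≤ P {ω | ∀ x ∈ D, ‖ξ x ω - f x‖ < ε}

/-- The families of functions that are `ε`-close to `F_j` on `D` for all `j < N`. -/
def tube {E : Type*} [NormedAddCommGroup E] (F : ℕ → X → E) (ε : ℝ) (N : ℕ) (D : Finset X) :
    Set (ℕ → X → E) :=
  {g | ∀ j < N, ∀ x ∈ D, ‖g j x - F j x‖ < ε}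

theorem measurableSet_finite_tube {E : Type*} [NormedAddCommGroup E] [MeasurableSpace E]
    [BorelSpace E] [SecondCountableTopology E] (f : X → E) (ε : ℝ) (D : Finset X) :
    MeasurableSet {g : X → E | ∀ x ∈ D, ‖g x - f x‖ < ε} := by
  have : {g : X → E | ∀ x ∈ D, ‖g x - f x‖ < ε} = ⋂ x ∈ D, {g : X → E | ‖g x - f x‖ < ε} := by
    ext g
    simp
  rw [this]
  refine Finset.measurableSet_biInter _ fun x _ => ?_
  exact measurableSet_lt (((measurable_pi_apply x).sub_const _).norm) measurable_const

theorem tube_eq_biInter {E : Type*} [NormedAddCommGroup E] (F : ℕ → X → E) (ε : ℝ) (N : ℕ)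
    (D : Finset X) : tube F ε N D = ⋂ j ∈ Finset.range N,
      (fun g : ℕ → X → E => g j) ⁻¹' {g : X → E | ∀ x ∈ D, ‖g x - F j x‖ < ε} := by
  ext g
  simp [tube]

theorem measurableSet_tube {E : Type*} [NormedAddCommGroup E] [MeasurableSpace E]
    [BorelSpace E] [SecondCountableTopology E] (F : ℕ → X → E) (ε : ℝ) (N : ℕ) (D : Finset X) :
    MeasurableSet (tube F ε N D) := by
  rw [tube_eq_biInter]
  exact Finset.measurableSet_biInter _ fun j _ =>
    (measurable_pi_apply j) (measurableSet_finite_tube (F j) ε D)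

theorem exists_le_measure_tube {E : Type*} [NormedAddCommGroup E] [MeasurableSpace E]
    [BorelSpace E] [SecondCountableTopology E] {ξ : ℕ → X → Ω → E}
    (hind : iIndepFun (fun j ω x => ξ j x ω) P) {F : ℕ → X → E} {ε : ℝ} {N : ℕ}
    (hF : ∀ j < N, ChargesTubes P (ξ j) (F j) ε) :
    ∃ c : ℝ≥0∞, c ≠ 0 ∧ ∀ D, c ≤ P ((fun ω j x => ξ j x ω) ⁻¹' tube F ε N D) := by
  choose! c hc0 hc using hF
  refine ⟨∏ j ∈ Finset.range N, c j,
    Finset.prod_ne_zero_iff.2 fun j hj => hc0 j (Finset.mem_range.1 hj), fun D => ?_⟩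
  have h1 := hind.measure_inter_preimage_eq_mul (Finset.range N)
    (sets := fun j => {g : X → E | ∀ x ∈ D, ‖g x - F j x‖ < ε})
    fun j _ => measurableSet_finite_tube (F j) ε D
  have h2 : (fun ω j x => ξ j x ω) ⁻¹' tube F ε N D = ⋂ j ∈ Finset.range N,
      (fun ω x => ξ j x ω) ⁻¹' {g : X → E | ∀ x ∈ D, ‖g x - F j x‖ < ε} := by
    ext ω
    simp [tube]
  rw [h2, h1]
  exact Finset.prod_le_prod' fun j hj => hc j (Finset.mem_range.1 hj) D

variable {k : Ω → ℕ} {V : ℕ → X → Ω → ℝ} {θ : ℕ → X → Ω → Fin m → ℝ} {q₀ : X → simplex m → ℝ}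

/-- By independence of weights, atoms and degree, a dominating target makes the random density
exceed `t q₀` at the predictors in `D` with a probability bounded below uniformly in `D`. -/
theorem IsRandomMixture.exists_le_measure_dominating (hM : IsRandomMixture P k V θ)
    {t : ℝ} {n N : ℕ} (hn : P (k ⁻¹' {n}) ≠ 0) {v : ℕ → X → ℝ} {ε : ℝ} {F : ℕ → X → Fin m → ℝ}
    {r : ℝ} (htarget : IsDominatingTarget q₀ t n N v ε F r)
    (hv : ∀ j < N, ChargesTubes P (V j) (v j) ε) (hF : ∀ j < N, ChargesTubes P (θ j) (F j) r) :
    ∃ c : ℝ≥0∞, c ≠ 0 ∧ ∀ D : Finset X, c ≤ P {ω | ∀ x ∈ D, ∀ y,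
      t * q₀ x y ≤ mixtureDensity (k ω) (fun j => V j x ω) (fun j => θ j x ω) y} := by
  obtain ⟨c₁, hc₁0, hc₁⟩ := exists_le_measure_tube hM.iIndepFun_weight hv
  obtain ⟨c₂, hc₂0, hc₂⟩ := exists_le_measure_tube hM.iIndepFun_atom hF
  refine ⟨c₁ * (c₂ * P (k ⁻¹' {n})), mul_ne_zero hc₁0 (mul_ne_zero hc₂0 hn), fun D => ?_⟩
  have h1 := hM.indep_atom.measure_inter_preimage_eq_mul _ _ (measurableSet_tube F r N D)
    (measurableSet_singleton n)
  have h2 := hM.indep_weight.measure_inter_preimage_eq_mul _ _ (measurableSet_tube v ε N D)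
    ((measurableSet_tube F r N D).prod (measurableSet_singleton n))
  have h3 : (fun ω => ((fun j x => θ j x ω : ℕ → X → Fin m → ℝ), k ω)) ⁻¹'
      (tube F r N D ×ˢ {n}) = (fun ω j x => θ j x ω) ⁻¹' tube F r N D ∩ k ⁻¹' {n} := rfl
  rw [h3, h1] at h2
  refine (mul_le_mul' (hc₁ D) (mul_le_mul' (hc₂ D) le_rfl)).trans (h2.symm.le.trans ?_)
  refine measure_mono ?_
  rintro ω ⟨hωV, hωθ, hωk⟩ x hx y
  rw [show k ω = n from hωk]
  exact htarget x y _ _ (fun j => hM.weight_mem j x ω) (fun j => hM.atom_mem j x ω)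
    (fun j hj => hωV j hj x hx) (fun j hj => hωθ j hj x hx)

/-- If the random conditional density exceeds `t q₀` at finitely many predictors with probability
bounded below, for each `t < 1`, then the posterior is weakly consistent. -/
theorem IsRandomMixture.posteriorWeaklyConsistentAt [IsProbabilityMeasure P] (hm : 1 ≤ m)
    (hM : IsRandomMixture P k V θ) {ν : Measure X} [SigmaFinite ν] {q : X → ℝ}
    (hq : IsPredictorDensity ν q) (hq₀ : IsContinuousDensityFamily q₀)
    (hdom : ∀ t : ℝ, 0 < t → t < 1 → ∃ c : ℝ≥0∞, c ≠ 0 ∧ ∀ D : Finset X, c ≤ P {ω | ∀ x ∈ D, ∀ y,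
      t * q₀ x y ≤ mixtureDensity (k ω) (fun j => V j x ω) (fun j => θ j x ω) y}) :
    PosteriorWeaklyConsistentAt P ((lebesgue m).prod ν)
      (fun ω => jointDensity q
        (fun x y => mixtureDensity (k ω) (fun j => V j x ω) (fun j => θ j x ω) y))
      (trueLaw hq hq₀) := by
  have hH : Measurable (Function.uncurry fun ω e => ENNReal.ofReal (jointDensity q
      (fun x y => mixtureDensity (k ω) (fun j => V j x ω) (fun j => θ j x ω) y) e)) := by
    simp only [jointDensity, ENNReal.ofReal_mul (hq.nonneg _)]
    exact (hq.measurable.comp (measurable_snd.comp measurable_snd)).ennreal_ofReal.mul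
      (hM.measurable_mixtureDensity hm)
  have hh₀ : Measurable fun e : simplex m × X => ENNReal.ofReal (jointDensity q q₀ e) :=
    ((hq.measurable.comp measurable_snd).mul hq₀.continuous.measurable).ennreal_ofReal
  refine posteriorWeaklyConsistentAt_of_dominatesTruth hH hh₀ (fun e => ENNReal.ofReal_ne_top) rfl
    (hM.ae_lintegral_jointDensity hm hq) ?_
  intro t ht1
  -- a positive real number between `t` and `1`
  set s : ℝ := max t.toReal (1 / 2) with hs
  have htT : t ≠ ∞ := ht1.ne_top
  have hs0 : 0 < s := lt_max_of_lt_right (by norm_num)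
  have hs1 : s < 1 := max_lt (by
    have := (ENNReal.toReal_lt_toReal htT ENNReal.one_ne_top).2 ht1
    simpa using this) (by norm_num)
  have hts : t ≤ ENNReal.ofReal s := by
    rw [← ENNReal.ofReal_toReal htT]
    exact ENNReal.ofReal_le_ofReal (le_max_left _ _)
  obtain ⟨c, hc0, hc⟩ := hdom s hs0 hs1
  refine ⟨c, hc0, ne_top_of_le_ne_top ENNReal.one_ne_top ((hc ∅).trans prob_le_one), ?_⟩
  intro n d
  set B : ℝ≥0∞ := t ^ n * ∏ i ∈ Finset.range n, ENNReal.ofReal (jointDensity q q₀ (d i)) with hB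
  set L : Ω → ℝ≥0∞ := fun ω => ∏ i ∈ Finset.range n, ENNReal.ofReal (jointDensity q
      (fun x y => mixtureDensity (k ω) (fun j => V j x ω) (fun j => θ j x ω) y) (d i)) with hL
  have hLm : Measurable L := Finset.measurable_fun_prod _ fun i _ =>
    hH.comp (measurable_id.prodMk measurable_const)
  have hle : c ≤ P {ω | B ≤ L ω} := by
    classical
    refine (hc ((Finset.range n).image fun i => (d i).2)).trans (measure_mono ?_)
    intro ω hω
    show B ≤ L ω
    rw [hB, hL, ← Finset.card_range n, ← Finset.prod_const, Finset.card_range,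
      ← Finset.prod_mul_distrib]
    refine Finset.prod_le_prod' fun i hi => ?_
    have h1 := hω (d i).2 (Finset.mem_image_of_mem (fun i => (d i).2) hi) (d i).1
    calc t * ENNReal.ofReal (jointDensity q q₀ (d i))
        ≤ ENNReal.ofReal s * ENNReal.ofReal (jointDensity q q₀ (d i)) := by gcongr
      _ = ENNReal.ofReal (q (d i).2 * (s * q₀ (d i).2 (d i).1)) := by
          rw [← ENNReal.ofReal_mul hs0.le]
          congr 1
          simp only [jointDensity]
          ring
      _ ≤ _ := ENNReal.ofReal_le_ofReal (mul_le_mul_of_nonneg_left h1 (hq.nonneg _))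
  calc c * t ^ n * ∏ i ∈ Finset.range n, ENNReal.ofReal (jointDensity q q₀ (d i)) = B * c := by
        rw [hB]; ring
    _ ≤ B * P {ω | B ≤ L ω} := by gcongr
    _ ≤ ∫⁻ ω, L ω ∂P := mul_meas_ge_le_lintegral hLm B

end Tubes

/-! ### The three models -/

section Models

variable {Ω : Type*} [MeasurableSpace Ω] {m p : ℕ} {X : Set (Fin p → ℝ)} {P : Measure Ω}
  {k : Ω → ℕ}

theorem simplexInterior_subset (m : ℕ) : simplexInterior m ⊆ simplexPos m := fun _ hy =>
  ⟨⟨fun i => ⟨(hy.1 i).le, (Finset.single_le_sum (fun j _ => (hy.1 j).le)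
    (Finset.mem_univ i)).trans hy.2.le⟩, hy.2.le⟩, hy.1⟩

theorem norm_sub_le_one_of_mem_simplex {a b : Fin m → ℝ} (ha : a ∈ simplex m)
    (hb : b ∈ simplex m) : ‖a - b‖ ≤ 1 := by
  rw [pi_norm_le_iff_of_nonneg zero_le_one]
  intro i
  rw [Pi.sub_apply, Real.norm_eq_abs, abs_le]
  constructor <;> linarith [(ha.1 i).1, (ha.1 i).2, (hb.1 i).1, (hb.1 i).2]

theorem IsWeightLink.measurable {v : X → ℝ → ℝ} (hv : IsWeightLink v) {η : X → Ω → ℝ}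
    (hη : Measurable fun a : X × Ω => η a.1 a.2) :
    Measurable fun a : X × Ω => v a.1 (η a.1 a.2) :=
  (measurable_uncurry_of_continuous_of_measurable (u := fun b x => v x b) hv.continuous
    fun b => (hv.continuous_left b).measurable).comp (hη.prodMk measurable_fst)

theorem IsAtomLink.measurable {h : X → (Fin m → ℝ) → (Fin m → ℝ)} (hh : IsAtomLink h)
    {z : X → Ω → (Fin m → ℝ)} (hz : Measurable fun a : X × Ω => z a.1 a.2) :
    Measurable fun a : X × Ω => h a.1 (z a.1 a.2) :=
  (measurable_uncurry_of_continuous_of_measurable (u := fun b x => h x b) hh.continuous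
    fun b => (hh.continuous_left b).measurable).comp (hz.prodMk measurable_fst)

theorem IsWeightLink.mem {v : X → ℝ → ℝ} (hv : IsWeightLink v) (x : X) (b : ℝ) :
    v x b ∈ Set.Ioo (0 : ℝ) 1 := (hv.bijOn x).mapsTo (Set.mem_univ b)

theorem IsAtomLink.mem {h : X → (Fin m → ℝ) → (Fin m → ℝ)} (hh : IsAtomLink h) (x : X)
    (b : Fin m → ℝ) : h x b ∈ simplexPos m :=
  simplexInterior_subset m ((hh.bijOn x).mapsTo (Set.mem_univ b))

/-- Applying the links to all paths is a measurable operation. -/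
theorem IsWeightLink.measurable_path {v : X → ℝ → ℝ} (hv : IsWeightLink v) :
    Measurable fun (f : X → ℝ) (x : X) => v x (f x) :=
  measurable_pi_lambda _ fun x => (hv.continuous x).measurable.comp (measurable_pi_apply x)

theorem IsAtomLink.measurable_path {h : X → (Fin m → ℝ) → (Fin m → ℝ)} (hh : IsAtomLink h) :
    Measurable fun (f : X → Fin m → ℝ) (x : X) => h x (f x) :=
  measurable_pi_lambda _ fun x => (hh.continuous x).measurable.comp (measurable_pi_apply x)

theorem measurable_map_family {A B : Type*} [MeasurableSpace A] [MeasurableSpace B] {g : A → B}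
    (hg : Measurable g) : Measurable fun (f : ℕ → A) (j : ℕ) => g (f j) :=
  measurable_pi_lambda _ fun j => hg.comp (measurable_pi_apply j)

theorem measurable_const_path {A : Type*} [MeasurableSpace A] :
    Measurable fun (a : A) (_ : X) => a := measurable_pi_lambda _ fun _ => measurable_id

theorem IsDMBPP.isRandomMixture [IsProbabilityMeasure P] {v : X → ℝ → ℝ}
    {h : X → (Fin m → ℝ) → (Fin m → ℝ)} {η : ℕ → X → Ω → ℝ} {z : ℕ → X → Ω → (Fin m → ℝ)}
    (H : IsDMBPP P k v h η z) :
    IsRandomMixture P k (fun j x ω => v x (η j x ω)) (fun j x ω => h x (z j x ω)) where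
  degree := H.degree
  measurable_weight j := H.weightLink.measurable (H.iid_weight.measurable j)
  weight_mem j x ω := Set.Ioo_subset_Icc_self (H.weightLink.mem x _)
  iIndepFun_weight := H.iid_weight.indep.comp _ fun _ => H.weightLink.measurable_path
  identDistrib_weight i j x := (H.iid_weight.identDistrib i j).comp
    ((H.weightLink.continuous x).measurable.comp (measurable_pi_apply x))
  weight_pos x := by simp [(H.weightLink.mem x _).1]
  measurable_atom j := H.atomLink.measurable (H.iid_atom.measurable j)
  atom_mem j x ω := H.atomLink.mem x _
  iIndepFun_atom := H.iid_atom.indep.comp _ fun _ => H.atomLink.measurable_path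
  indep_weight := H.indep_weight.comp (measurable_map_family H.weightLink.measurable_path)
    ((measurable_map_family H.atomLink.measurable_path).prodMap measurable_id)
  indep_atom := H.indep_atom.comp (measurable_map_family H.atomLink.measurable_path) measurable_id

theorem IsThetaDMBPP.isRandomMixture [IsProbabilityMeasure P] {v : X → ℝ → ℝ}
    {η : ℕ → X → Ω → ℝ} {θ : ℕ → Ω → (Fin m → ℝ)} (H : IsThetaDMBPP P k v η θ) :
    IsRandomMixture P k (fun j x ω => v x (η j x ω)) (fun j (_ : X) ω => θ j ω) where
  degree := H.degree
  measurable_weight j := H.weightLink.measurable (H.iid_weight.measurable j)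
  weight_mem j x ω := Set.Ioo_subset_Icc_self (H.weightLink.mem x _)
  iIndepFun_weight := H.iid_weight.indep.comp _ fun _ => H.weightLink.measurable_path
  identDistrib_weight i j x := (H.iid_weight.identDistrib i j).comp
    ((H.weightLink.continuous x).measurable.comp (measurable_pi_apply x))
  weight_pos x := by simp [(H.weightLink.mem x _).1]
  measurable_atom j := (H.iid_atom.measurable j).comp measurable_snd
  atom_mem j x ω := H.atom_mem j ω
  iIndepFun_atom := H.iid_atom.indep.comp _ fun _ => measurable_const_path
  indep_weight := H.indep_weight.comp (measurable_map_family H.weightLink.measurable_path)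
    ((measurable_map_family measurable_const_path).prodMap measurable_id)
  indep_atom := H.indep_atom.comp (measurable_map_family measurable_const_path) measurable_id

theorem HasFullSupportOn.measure_norm_sub_lt_ne_zero {E : Type*} [NormedAddCommGroup E]
    [MeasurableSpace E] [BorelSpace E] {ξ : Ω → E} (hξ : Measurable ξ) {S : Set E}
    (hS : HasFullSupportOn P ξ S) {a : E} (ha : a ∈ S) {ε : ℝ} (hε : 0 < ε) :
    P {ω | ‖ξ ω - a‖ < ε} ≠ 0 := by
  have h1 := (Measure.mem_support_iff_forall a).1 (hS ha) _ (Metric.ball_mem_nhds a hε)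
  rw [Measure.map_apply hξ Metric.isOpen_ball.measurableSet] at h1
  have h2 : ξ ⁻¹' Metric.ball a ε = {ω | ‖ξ ω - a‖ < ε} := by
    ext ω
    simp [dist_eq_norm]
  rw [h2] at h1
  exact h1.ne'

theorem IsWDMBPP.isRandomMixture [IsProbabilityMeasure P] {h : X → (Fin m → ℝ) → (Fin m → ℝ)}
    {V : ℕ → Ω → ℝ} {z : ℕ → X → Ω → (Fin m → ℝ)} (H : IsWDMBPP P k h V z)
    (hV : HasFullSupportOn P (V 0) (Set.Icc 0 1)) :
    IsRandomMixture P k (fun j (_ : X) ω => V j ω) (fun j x ω => h x (z j x ω)) where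
  degree := H.degree
  measurable_weight j := (H.iid_weight.measurable j).comp measurable_snd
  weight_mem j x ω := H.weight_mem j ω
  iIndepFun_weight := H.iid_weight.indep.comp _ fun _ => measurable_const_path
  identDistrib_weight i j x := H.iid_weight.identDistrib i j
  weight_pos x h0 := by
    refine hV.measure_norm_sub_lt_ne_zero (H.iid_weight.measurable 0) (a := 1) (by simp) one_pos
      (measure_mono_null ?_ h0)
    intro ω (hω : ‖V 0 ω - 1‖ < 1)
    rw [Real.norm_eq_abs, abs_lt] at hω
    show 0 < V 0 ω
    linarith [hω.1]
  measurable_atom j := H.atomLink.measurable (H.iid_atom.measurable j)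
  atom_mem j x ω := H.atomLink.mem x _
  iIndepFun_atom := H.iid_atom.indep.comp _ fun _ => H.atomLink.measurable_path
  indep_weight := H.indep_weight.comp (measurable_map_family measurable_const_path)
    ((measurable_map_family H.atomLink.measurable_path).prodMap measurable_id)
  indep_atom := H.indep_atom.comp (measurable_map_family H.atomLink.measurable_path) measurable_id

/-- A constant random function charges the tubes around the constants in its support. -/
theorem HasFullSupportOn.chargesTubes {E : Type*} [NormedAddCommGroup E] [MeasurableSpace E]
    [BorelSpace E] {ξ : Ω → E} (hξ : Measurable ξ) {S : Set E} (hS : HasFullSupportOn P ξ S) {a : E}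
    (ha : a ∈ S) {ε : ℝ} (hε : 0 < ε) :
    ChargesTubes P (fun (_ : X) ω => ξ ω) (fun _ => a) ε :=
  ⟨_, hS.measure_norm_sub_lt_ne_zero hξ ha hε, fun _ => measure_mono fun _ hω _ _ => hω⟩

/-- For a uniformly bounded difference, the supremum in the support conditions is a genuine one. -/
theorem chargesTubes_of_iSup {E : Type*} [NormedAddCommGroup E] {ξ : X → Ω → E} {f : X → E}
    {C ε : ℝ} (hC : ∀ x ω, ‖ξ x ω - f x‖ ≤ C) (h : 0 < P {ω | ⨆ x : X, ‖ξ x ω - f x‖ < ε}) :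
    ChargesTubes P ξ f ε := by
  refine ⟨_, h.ne', fun D => measure_mono fun ω hω x _ => ?_⟩
  exact (le_ciSup (f := fun x => ‖ξ x ω - f x‖)
    ⟨C, Set.forall_mem_range.2 fun x => hC x ω⟩ x).trans_lt hω

theorem WeightProcessFullSupport.chargesTubes {v : X → ℝ → ℝ} (hv : IsWeightLink v)
    {η : ℕ → X → Ω → ℝ} (hη : WeightProcessFullSupport P v η) {f : X → ℝ} (hf : Continuous f)
    (hf01 : ∀ x, f x ∈ Set.Icc (0 : ℝ) 1) (j : ℕ) {ε : ℝ} (hε : 0 < ε) :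
    ChargesTubes P (fun x ω => v x (η j x ω)) f ε := by
  refine chargesTubes_of_iSup (C := 1) (fun x ω => ?_) (hη f hf hf01 j ε hε)
  have h1 := hv.mem x (η j x ω)
  have h2 := hf01 x
  rw [Real.norm_eq_abs, abs_le]
  constructor <;> linarith [h1.1, h1.2, h2.1, h2.2]

theorem AtomProcessFullSupport.chargesTubes {h : X → (Fin m → ℝ) → (Fin m → ℝ)}
    (hh : IsAtomLink h) {z : ℕ → X → Ω → (Fin m → ℝ)} (hz : AtomProcessFullSupport P h z)
    {f : X → Fin m → ℝ} (hf : Continuous f) (hfm : ∀ x, f x ∈ simplexPos m) (j : ℕ) {ε : ℝ}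
    (hε : 0 < ε) : ChargesTubes P (fun x ω => h x (z j x ω)) f ε :=
  chargesTubes_of_iSup (C := 1)
    (fun x ω => norm_sub_le_one_of_mem_simplex (hh.mem x (z j x ω)).1 (hfm x).1)
    (hz f hf hfm j ε hε)

/-- Weight processes charge the tubes around the stick-breaking fractions of a finite mixture. -/
theorem FiniteMixtureBelow.chargesTubes_weight {q₀ : X → simplex m → ℝ} {t : ℝ}
    (A : FiniteMixtureBelow q₀ t) {v : X → ℝ → ℝ} (hv : IsWeightLink v)
    {η : ℕ → X → Ω → ℝ} (hη : WeightProcessFullSupport P v η) {j : ℕ} (hj : j < A.N) :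
    ChargesTubes P (fun x ω => v x (η j x ω))
      (fun x => stickFraction (fun i => A.W i x) j) (A.ρ / (A.N + 1)) := by
  refine hη.chargesTubes hv ?_ (fun x => stickFraction_mem (fun i => A.W_nonneg i x)
    (A.sum_W_lt_one x) hj) j (div_pos A.ρ_pos (by positivity))
  unfold stickFraction
  refine (A.continuous_W j).div (continuous_const.sub
    (continuous_finsetSum _ fun i _ => A.continuous_W i)) fun x => ?_
  have := sum_range_lt_one (fun i => A.W_nonneg i x) (A.sum_W_lt_one x) hj.le
  linarith

end Models

end DMBPP

end

theorem theorem11 {Ω : Type*} [MeasurableSpace Ω] (P : Measure Ω) [IsProbabilityMeasure P]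
    {m p : ℕ} (hm : 1 ≤ m) (X : Set (Fin p → ℝ)) (hX : IsCompact X)
    (ν : Measure X) [SigmaFinite ν] (q : X → ℝ) (hq : DMBPP.IsPredictorDensity ν q)
    (q₀ : X → DMBPP.simplex m → ℝ) (hq₀ : DMBPP.IsContinuousDensityFamily q₀)
    (k : Ω → ℕ) (hk : ∀ n, 1 ≤ n → 0 < P (k ⁻¹' {n})) :
    (∀ (v : X → ℝ → ℝ) (h : X → (Fin m → ℝ) → (Fin m → ℝ))
        (η : ℕ → X → Ω → ℝ) (z : ℕ → X → Ω → (Fin m → ℝ)),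
      DMBPP.IsDMBPP P k v h η z →
      DMBPP.AtomProcessFullSupport P h z →
      DMBPP.WeightProcessFullSupport P v η →
      DMBPP.PosteriorWeaklyConsistentAt P ((DMBPP.lebesgue m).prod ν)
        (fun ω => DMBPP.jointDensity q (DMBPP.densityDMBPP k v h η z ω))
        (DMBPP.trueLaw hq hq₀)) ∧
    (∀ (v : X → ℝ → ℝ) (η : ℕ → X → Ω → ℝ) (θ : ℕ → Ω → (Fin m → ℝ)),
      DMBPP.IsThetaDMBPP P k v η θ →
      DMBPP.WeightProcessFullSupport P v η →
      (∀ j, DMBPP.HasFullSupportOn P (θ j) (DMBPP.simplexPos m)) →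
      DMBPP.PosteriorWeaklyConsistentAt P ((DMBPP.lebesgue m).prod ν)
        (fun ω => DMBPP.jointDensity q (DMBPP.densityThetaDMBPP k v η θ ω))
        (DMBPP.trueLaw hq hq₀)) ∧
    (∀ (h : X → (Fin m → ℝ) → (Fin m → ℝ)) (V : ℕ → Ω → ℝ)
        (z : ℕ → X → Ω → (Fin m → ℝ)),
      DMBPP.IsWDMBPP P k h V z →
      DMBPP.AtomProcessFullSupport P h z →
      (∀ j, DMBPP.HasFullSupportOn P (V j) (Set.Icc 0 1)) →
      DMBPP.PosteriorWeaklyConsistentAt P ((DMBPP.lebesgue m).prod ν)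
        (fun ω => DMBPP.jointDensity q (DMBPP.densityWDMBPP k h V z ω))
        (DMBPP.trueLaw hq hq₀)) := by

  refine ⟨?_, ?_, ?_⟩
  · intro v h η z H hz hη
    refine H.isRandomMixture.posteriorWeaklyConsistentAt hm hq hq₀ fun t ht0 ht1 => ?_
    obtain ⟨A⟩ := DMBPP.nonempty_finiteMixtureBelow hm hX hq₀ ht0 ht1
    exact H.isRandomMixture.exists_le_measure_dominating (hk A.k A.one_le_k).ne'
      (A.isDominatingTarget_constAtoms hm)
      (fun j hj => A.chargesTubes_weight H.weightLink hη hj)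
      (fun j _ => hz.chargesTubes H.atomLink continuous_const (fun _ => A.c_mem j) j A.r_pos)
  · intro v η θ H hη hθ
    refine H.isRandomMixture.posteriorWeaklyConsistentAt hm hq hq₀ fun t ht0 ht1 => ?_
    obtain ⟨A⟩ := DMBPP.nonempty_finiteMixtureBelow hm hX hq₀ ht0 ht1
    exact H.isRandomMixture.exists_le_measure_dominating (hk A.k A.one_le_k).ne'
      (A.isDominatingTarget_constAtoms hm)
      (fun j hj => A.chargesTubes_weight H.weightLink hη hj)
      (fun j _ => (hθ j).chargesTubes (H.iid_atom.measurable j) (A.c_mem j) A.r_pos)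
  · intro h V z H hz hV
    have hM := H.isRandomMixture (hV 0)
    refine hM.posteriorWeaklyConsistentAt hm hq hq₀ fun t ht0 ht1 => ?_
    obtain ⟨A⟩ := DMBPP.nonempty_finiteMixtureBelow hm hX hq₀ ht0 ht1
    obtain ⟨M, w, ε, F, hw, hε, hFc, hFm, htarget⟩ :=
      A.exists_isDominatingTarget_constWeights hm
    exact hM.exists_le_measure_dominating (hk A.k A.one_le_k).ne' htarget
      (fun j hj => (hV j).chargesTubes (H.iid_weight.measurable j) (hw j hj) hε)
      (fun j _ => hz.chargesTubes H.atomLink (hFc j) (hFm j) j A.r_pos)
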